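/- Let $N$ be a smooth manifold (finite-dimensional, without boundary, Hausdorff, paracompact) and $\omega$ a smooth closed $2$-form on $N$. For an abelian group $A$ let $H^n(N,A)$ be the Čech cohomology of the sheaf of locally constant $A$-valued functions on $N$ (the colimit over open covers). Let $T^1$ be the circle group, with Lie algebra identified with $\mathbb R$ through $t\mapsto \exp(2\pi i t)$. Let $C(\omega)$ be the gerbe, with band the locally constant $T^1$-valued functions, whose objects over an open set $U\subseteq N$ are the smooth principal $T^1$-bundles over $U$ with a connection of curvature $\omega|_U$ and whose morphisms are the bundle maps over the identity that preserve the connections. Let $C'(\omega)$ be the gerbe, with band the locally constant $\mathbb R$-valued functions, whose classifying class is the image of $[\omega]$ under the isomorphism between de Rham and Čech cohomology; its objects over $U$ are represented by the smooth $1$-forms $\alpha$ on $U$ with $d\alpha=\omega|_U$, and a morphism $\alpha\to\alpha'$ is a smooth function $u$ with $du=\alpha-\alpha'$ (composition is addition). For either gerbe a classifying cocycle on an open cover $(U_i)_{i\in I}$ is obtained by choosing objects $e_i$ over $U_i$ and morphisms $g_{ij}\colon e_j\to e_i$ over $U_i\cap U_j$ and setting $c_{ijk}=g_{ij}\,g_{jk}\,g_{ik}^{-1}$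 on $U_i\cap U_j\cap U_k$. Thus for $C'(\omega)$ one chooses $d\alpha_i=\omega|_{U_i}$ and $du_{ij}=\alpha_j-\alpha_i$, and $c_{ijk}=u_{jk}-u_{ik}+u_{ij}$. Then: 1. The exact sequence $0\to\mathbb Z\to\mathbb R\to T^1\to 1$ of sheaves of locally constant functions, where $\mathbb R\to T^1$ is $x\mapsto \exp(2\pi i x)$, induces a long exact sequence $$\cdots\to H^n(N,\mathbb Z)\to H^n(N,\mathbb R)\to H^n(N,T^1)\xrightarrow{\ \delta\ }H^{n+1}(N,\mathbb Z)\to H^{n+1}(N,\mathbb R)\to\cdots,$$ where $\delta$ is the connecting homomorphism; in particular $H^1(N,T^1)\to H^2(N,\mathbb Z)\to H^2(N,\mathbb R)\to H^2(N,T^1)$ is exact. 2. Each of the two gerbes has classifying cocycles, their classes $[c'_\omega]\in H^2(N,\mathbb R)$ and $[c_\omega]\in H^2(N,T^1)$ do not depend on the choices, and the map $H^2(N,\mathbb R)\to H^2(N,T^1)$ sends $[c'_\omega]$ to $[c_\omega]$. 3. If $c$ is a classifying cocycle of $C'(\omega)$ on an open cover $(U_i)_{i\in I}$, then $\exp(2\pi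 i\,c)$ is a classifying cocycle of $C(\omega)$ on the same cover. -/

import Mathlib

open TopologicalSpace Set
open scoped Manifold ContDiff Topology

universe u v w

noncomputable section

/-! ### Čech cohomology with coefficients in locally constant functions -/

section Cech

variable {N : Type u} [TopologicalSpace N]

/-- The open set `U_{s 0} ∩ ... ∩ U_{s (n-1)}`. -/
def overlap {I : Type v} (U : I → Opens N) {n : ℕ} (s : Fin n → I) : Opens N :=
  ⟨⋂ a, (U (s a) : Set N), isOpen_iInter_of_finite fun a => (U (s a)).isOpen⟩

theorem overlap_le {I : Type v} (U : I → Opens N) {n : ℕ} (s : Fin n → I) (a : Fin n) :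
    overlap U s ≤ U (s a) := fun _ hx => Set.mem_iInter.1 hx a

theorem overlap_mono {I : Type v} {J : Type w} {U : I → Opens N} {V : J → Opens N} (τ : J → I)
    (h : ∀ j, V j ≤ U (τ j)) {n : ℕ} (s : Fin n → J) : overlap V s ≤ overlap U (τ ∘ s) :=
  fun _ hx => Set.mem_iInter.2 fun a => h (s a) (Set.mem_iInter.1 hx a)

theorem overlap_face {I : Type v} (U : I → Opens N) {n : ℕ} (s : Fin (n + 1) → I)
    (j : Fin (n + 1)) : overlap U s ≤ overlap U (s ∘ j.succAbove) :=
  fun _ hx => Set.mem_iInter.2 fun a => Set.mem_iInter.1 hx (j.succAbove a)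

/-- Restriction of locally constant functions from `W` to `V ⊆ W`. -/
def lcRes (A : Type*) [AddCommGroup A] {V W : Opens N} (h : V ≤ W) :
    LocallyConstant W A →+ LocallyConstant V A :=
  LocallyConstant.comapAddMonoidHom
    (⟨Set.inclusion h, continuous_inclusion h⟩ : C((V : Set N), (W : Set N)))

/-- Change of coefficients. -/
def lcMap {A B : Type*} [AddCommGroup A] [AddCommGroup B] (φ : A →+ B) (V : Opens N) :
    LocallyConstant V A →+ LocallyConstant V B where
  toFun f := f.map φ
  map_zero' := by ext; simp
  map_add' f g := by ext; simp

/-- Čech `n`-cochains of the family `U` with values in the sheaf of locally constant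
`A`-valued functions. -/
abbrev CechCochain {I : Type v} (U : I → Opens N) (A : Type*) [AddCommGroup A] (n : ℕ) :=
  (s : Fin (n + 1) → I) → LocallyConstant (overlap U s) A

variable {A B : Type*} [AddCommGroup A] [AddCommGroup B]

/-- The Čech differential
`(d c)_{i_0 ... i_{n+1}} = ∑_j (-1)^j c_{i_0 ... (omit i_j) ... i_{n+1}}`. -/
def cechD {I : Type v} (U : I → Opens N) (A : Type*) [AddCommGroup A] (n : ℕ) :
    CechCochain U A n →+ CechCochain U A (n + 1) where
  toFun c s := ∑ j : Fin (n + 2), (-1 : ℤ) ^ (j : ℕ) • lcRes A (overlap_face U s j)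
    (c (s ∘ j.succAbove))
  map_zero' := by funext s; simp
  map_add' c c' := by funext s; simp [Finset.sum_add_distrib]

/-- Čech `n`-cocycles. -/
abbrev CechCocycle {I : Type v} (U : I → Opens N) (A : Type*) [AddCommGroup A] (n : ℕ) :
    AddSubgroup (CechCochain U A n) := (cechD U A n).ker

/-- Čech `n`-coboundaries. -/
def cechBoundary {I : Type v} (U : I → Opens N) (A : Type*) [AddCommGroup A] :
    (n : ℕ) → AddSubgroup (CechCochain U A n)
  | 0 => ⊥
  | n + 1 => (cechD U A n).range

/-- The Čech cohomology group `H^n` of the family `U`. -/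
abbrev CechHCover {I : Type v} (U : I → Opens N) (A : Type*) [AddCommGroup A] (n : ℕ) :=
  CechCocycle U A n ⧸ (cechBoundary U A n).addSubgroupOf (CechCocycle U A n)

/-- Pull-back of cochains along a refinement `V j ⊆ U (τ j)`. -/
def cechRefine {I : Type v} {J : Type w} {U : I → Opens N} {V : J → Opens N} (τ : J → I)
    (h : ∀ j, V j ≤ U (τ j)) (A : Type*) [AddCommGroup A] (n : ℕ) :
    CechCochain U A n →+ CechCochain V A n where
  toFun c s := lcRes A (overlap_mono τ h s) (c (τ ∘ s))
  map_zero' := by funext s; simp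
  map_add' c c' := by funext s; simp

/-- Change of coefficients for cochains. -/
def cechCoeff {I : Type v} (U : I → Opens N) (φ : A →+ B) (n : ℕ) :
    CechCochain U A n →+ CechCochain U B n where
  toFun c s := lcMap φ _ (c s)
  map_zero' := by funext s; simp
  map_add' c c' := by funext s; simp

theorem cechD_cechRefine {I : Type v} {J : Type w} {U : I → Opens N} {V : J → Opens N} (τ : J → I)
    (h : ∀ j, V j ≤ U (τ j)) (n : ℕ) (c : CechCochain U A n) :
    cechD V A n (cechRefine τ h A n c) = cechRefine τ h A (n + 1) (cechD U A n c) := by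
  funext s
  simp only [cechD, cechRefine, AddMonoidHom.coe_mk, ZeroHom.coe_mk, map_sum, map_zsmul]
  rfl

theorem cechD_cechCoeff {I : Type v} (U : I → Opens N) (φ : A →+ B) (n : ℕ)
    (c : CechCochain U A n) :
    cechD U B n (cechCoeff U φ n c) = cechCoeff U φ (n + 1) (cechD U A n c) := by
  funext s
  simp only [cechD, cechCoeff, AddMonoidHom.coe_mk, ZeroHom.coe_mk, map_sum, map_zsmul]
  rfl

/-- Pull-back of cocycles along a refinement. -/
def cocycleRefine {I : Type v} {J : Type w} {U : I → Opens N} {V : J → Opens N} (τ : J → I)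
    (h : ∀ j, V j ≤ U (τ j)) (A : Type*) [AddCommGroup A] (n : ℕ) :
    CechCocycle U A n →+ CechCocycle V A n :=
  ((cechRefine τ h A n).comp (CechCocycle U A n).subtype).codRestrict _ fun c => by
    have hc : cechD U A n c = 0 := c.2
    simp [AddMonoidHom.mem_ker, cechD_cechRefine, hc]

/-- Change of coefficients for cocycles. -/
def cocycleCoeff {I : Type v} (U : I → Opens N) (φ : A →+ B) (n : ℕ) :
    CechCocycle U A n →+ CechCocycle U B n :=
  ((cechCoeff U φ n).comp (CechCocycle U A n).subtype).codRestrict _ fun c => by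
    have hc : cechD U A n c = 0 := c.2
    simp [AddMonoidHom.mem_ker, cechD_cechCoeff, hc]

/-- Pull-back along a refinement, on the cohomology of covers. -/
def hRefine {I : Type v} {J : Type w} {U : I → Opens N} {V : J → Opens N} (τ : J → I)
    (h : ∀ j, V j ≤ U (τ j)) (A : Type*) [AddCommGroup A] (n : ℕ) :
    CechHCover U A n →+ CechHCover V A n :=
  QuotientAddGroup.map _ _ (cocycleRefine τ h A n) (by
    rintro ⟨c, hc⟩ hb
    change c ∈ cechBoundary U A n at hb
    change cechRefine τ h A n c ∈ cechBoundary V A n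
    cases n with
    | zero =>
      have : c = 0 := hb
      simp [this]
    | succ n =>
      obtain ⟨b, rfl⟩ := hb
      exact ⟨cechRefine τ h A n b, cechD_cechRefine τ h n b⟩)

/-- Change of coefficients, on the cohomology of covers. -/
def hCoeffCover {I : Type v} (U : I → Opens N) (φ : A →+ B) (n : ℕ) :
    CechHCover U A n →+ CechHCover U B n :=
  QuotientAddGroup.map _ _ (cocycleCoeff U φ n) (by
    rintro ⟨c, hc⟩ hb
    change c ∈ cechBoundary U A n at hb
    change cechCoeff U φ n c ∈ cechBoundary U B n
    cases n with
    | zero =>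
      have : c = 0 := hb
      simp [this]
    | succ n =>
      obtain ⟨b, rfl⟩ := hb
      exact ⟨cechCoeff U φ n b, cechD_cechCoeff U φ n b⟩)

variable (N) in
/-- Open covers of `N` indexed by the points of `N`, the set with index `x` being a neighbourhood
of `x`. Every open cover has a refinement of this form, so that the colimit of the groups
`CechHCover` over these covers is the colimit over all open covers. -/
def PtCover := {W : N → Opens N // ∀ x, x ∈ W x}

/-- `W ≤ W'` when `W'` is finer than `W`. -/
instance : Preorder (PtCover N) where
  le W W' := ∀ x, W'.1 x ≤ W.1 x
  le_refl _ _ := le_rfl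
  le_trans _ _ _ h h' x := (h' x).trans (h x)

instance : DecidableEq (PtCover N) := Classical.decEq _

variable (N) in
/-- The Čech cohomology group `H^n(N, A)` of the sheaf of locally constant `A`-valued functions:
the colimit, over refinement of open covers, of the cohomology groups of the covers. -/
def CechH (A : Type*) [AddCommGroup A] (n : ℕ) : Type _ :=
  AddCommGroup.DirectLimit (fun W : PtCover N => CechHCover W.1 A n)
    (fun _ _ h => hRefine id h A n)

instance (n : ℕ) : AddCommGroup (CechH N A n) :=
  inferInstanceAs (AddCommGroup (AddCommGroup.DirectLimit
    (fun W : PtCover N => CechHCover W.1 A n) (fun _ _ h => hRefine id h A n)))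

/-- The class in `H^n(N, A)` of a cocycle of a cover indexed by the points. -/
def ptClass (W : PtCover N) (n : ℕ) : CechCocycle W.1 A n →+ CechH N A n :=
  (AddCommGroup.DirectLimit.of (fun W : PtCover N => CechHCover W.1 A n)
    (fun _ _ h => hRefine id h A n) W).comp (QuotientAddGroup.mk' _)

/-- The cover indexed by the points that assigns to `x` a member of the cover `U` containing `x`. -/
def ptRefinement {I : Type v} (U : I → Opens N) (hU : ∀ x, ∃ i, x ∈ U i) : PtCover N :=
  ⟨fun x => U (hU x).choose, fun x => (hU x).choose_spec⟩

/-- The class in `H^n(N, A)` of a cocycle of an arbitrary open cover `U`. -/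
def cechClass {I : Type v} (U : I → Opens N) (hU : ∀ x, ∃ i, x ∈ U i) (n : ℕ) :
    CechCocycle U A n →+ CechH N A n :=
  (ptClass (ptRefinement U hU) n).comp
    (cocycleRefine (fun x => (hU x).choose) (fun _ => le_rfl) A n)

variable (N) in
/-- The map `H^n(N, A) → H^n(N, B)` induced by a homomorphism `A → B`. -/
def cechHMap (φ : A →+ B) (n : ℕ) : CechH N A n →+ CechH N B n :=
  AddCommGroup.DirectLimit.map (fun W => hCoeffCover W.1 φ n) fun W W' h => by
    apply QuotientAddGroup.addMonoidHom_ext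
    rfl

/-- The circle `T^1`, written additively. -/
abbrev T1 := Additive Circle

/-- The map `ℝ → T^1`, `x ↦ exp (2 π i x)`. -/
def expT1 : ℝ →+ T1 := Circle.expHom.comp (AddMonoidHom.mulLeft (2 * Real.pi))

/-- The inclusion `ℤ → ℝ`. -/
def intIncl : ℤ →+ ℝ := Int.castAddHom ℝ

/-- `δ` is the connecting homomorphism of `0 → ℤ → ℝ → T^1 → 1` in degree `n`: if a
`T^1`-valued cocycle `g` is `exp (2 π i r)` for a real cochain `r`, and the integral cocycle `m`
is the coboundary of `r`, then `δ` sends the class of `g` to the class of `m`. -/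
def IsConnecting (n : ℕ) (δ : CechH N T1 n →+ CechH N ℤ (n + 1)) : Prop :=
  ∀ (W : PtCover N) (r : CechCochain W.1 ℝ n) (g : CechCocycle W.1 T1 n)
    (m : CechCocycle W.1 ℤ (n + 1)),
    cechCoeff W.1 expT1 n r = g → cechCoeff W.1 intIncl (n + 1) m = cechD W.1 ℝ n r →
      δ (ptClass W n g) = ptClass W (n + 1) m

end Cech

/-! ### Differential forms on manifolds -/

section Forms

variable {E : Type*} [NormedAddCommGroup E] [NormedSpace ℝ E] {H : Type*} [TopologicalSpace H]
  {E' : Type*} [NormedAddCommGroup E'] [NormedSpace ℝ E'] {H' : Type*} [TopologicalSpace H']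

/-- (Not necessarily smooth) differential `k`-forms on the manifold `M`. -/
abbrev DiffForm (J : ModelWithCorners ℝ E H) (M : Type*) [TopologicalSpace M] [ChartedSpace H M]
    (k : ℕ) := (x : M) → TangentSpace J x [⋀^Fin k]→L[ℝ] ℝ

namespace DiffForm

variable {J : ModelWithCorners ℝ E H} {M : Type*} [TopologicalSpace M] [ChartedSpace H M]
  {J' : ModelWithCorners ℝ E' H'} {M' : Type*} [TopologicalSpace M'] [ChartedSpace H' M'] {k : ℕ}

variable (J) in
/-- The pull-back `f^* η`. -/
def pullback (f : M → M') (η : DiffForm J' M' k) : DiffForm J M k :=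
  fun x => (η (f x)).compContinuousLinearMap (mfderiv J J' f x)

/-- The expression of a form in the chart around `x₀`, as a form on the model vector space. -/
def inChart (α : DiffForm J M k) (x₀ : M) : E → E [⋀^Fin k]→L[ℝ] ℝ :=
  pullback 𝓘(ℝ, E) (extChartAt J x₀).symm α

/-- The domain, in the chart around `x₀`, that corresponds to `V`. -/
def chartDomain (J : ModelWithCorners ℝ E H) (x₀ : M) (V : Set M) : Set E :=
  (extChartAt J x₀).target ∩ (extChartAt J x₀).symm ⁻¹' V

/-- `α` is smooth on the open set `V` (for manifolds without boundary). -/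
def SmoothOn (α : DiffForm J M k) (V : Set M) : Prop :=
  ∀ x₀ : M, ContDiffOn ℝ ∞ (α.inChart x₀) (chartDomain J x₀ V)

/-- `dα = β` on the open set `V` (for manifolds without boundary): in every chart, `β` is the
exterior derivative of `α`. -/
def IsExtDerivOn (α : DiffForm J M k) (β : DiffForm J M (k + 1)) (V : Set M) : Prop :=
  ∀ x₀ : M, ∀ y ∈ chartDomain J x₀ V, extDeriv (α.inChart x₀) y = β.inChart x₀ y

end DiffForm

end Forms

/-! ### The two gerbes of a closed `2`-form -/

section Gerbes

variable {E : Type*} [NormedAddCommGroup E] [NormedSpace ℝ E]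
  {N : Type u} [TopologicalSpace N] [ChartedSpace E N]

/-- The objects over `U` of the gerbe `C'(Ω)`: smooth `1`-forms `α` on `U` with `dα = Ω`,
that is, connections `d + α` with curvature `Ω` on the (trivial) principal `ℝ`-bundle over `U`.
Only the values of `form` on `U` matter. -/
structure RObj (Ω : DiffForm 𝓘(ℝ, E) N 2) (U : Opens N) where
  form : DiffForm 𝓘(ℝ, E) N 1
  smooth : form.SmoothOn U
  ext_deriv : form.IsExtDerivOn Ω U

/-- The morphisms over `V` between (the restrictions to `V` of) two objects of `C'(Ω)`: smooth
functions `u` on `V` such that translation by `u` takes the connection `d + α` to the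
connection `d + α'`, that is `du = α - α'`. Composition is addition, and the automorphisms of an
object are the locally constant real functions. -/
structure RHom {Ω : DiffForm 𝓘(ℝ, E) N 2} {U U' : Opens N} (e : RObj Ω U) (e' : RObj Ω U')
    (V : Opens N) where
  toFun : N → ℝ
  smooth : ContMDiffOn 𝓘(ℝ, E) 𝓘(ℝ, ℝ) ∞ toFun V
  deriv_eq : ∀ x ∈ V, ∀ v : TangentSpace 𝓘(ℝ, E) x,
    mfderiv 𝓘(ℝ, E) 𝓘(ℝ, ℝ) toFun x v = e.form x (fun _ => v) - e'.form x (fun _ => v)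

/-- `c` is the classifying cocycle of `C'(Ω)` for some choice of objects `e i` over `U i` and of
morphisms `g i j : e j → e i` over `U i ∩ U j`:
on triple intersections, `g i j ∘ g j k = c i j k ∘ g i k`. -/
def IsRClassifying (Ω : DiffForm 𝓘(ℝ, E) N 2) {I : Type w} (U : I → Opens N)
    (c : CechCochain U ℝ 2) : Prop :=
  ∃ (e : ∀ i, RObj Ω (U i)) (g : ∀ i j, RHom (e j) (e i) (U i ⊓ U j)),
    ∀ (s : Fin 3 → I) (x : overlap U s),
      (g (s 0) (s 1)).toFun x + (g (s 1) (s 2)).toFun x = c s x + (g (s 0) (s 2)).toFun x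

/-- The model with corners (without boundary) of the total space of a circle bundle. -/
abbrev totalModel (E : Type*) [NormedAddCommGroup E] [NormedSpace ℝ E] :
    ModelWithCorners ℝ (E × EuclideanSpace ℝ (Fin 1)) (ModelProd E (EuclideanSpace ℝ (Fin 1))) :=
  𝓘(ℝ, E).prod (𝓡 1)

/-- The objects over `U` of the gerbe `C(Ω)`: smooth principal `T^1`-bundles over `U` with a
connection of curvature `Ω`. The Lie algebra of `T^1` is identified with `ℝ` through the
exponential map `t ↦ exp (2 π i t)`, so that a connection form is a real `1`-form. -/
structure CircleBundle (Ω : DiffForm 𝓘(ℝ, E) N 2) (U : Opens N) where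
  /-- the total space -/
  P : Type u
  [top : TopologicalSpace P]
  [charted : ChartedSpace (ModelProd E (EuclideanSpace ℝ (Fin 1))) P]
  [manifold : IsManifold (totalModel E) ∞ P]
  [action : MulAction Circle P]
  smooth_smul : ContMDiff ((𝓡 1).prod (totalModel E)) (totalModel E) ∞
    (fun q : Circle × P => q.1 • q.2)
  /-- the projection to the base `U ⊆ N` -/
  proj : P → N
  smooth_proj : ContMDiff (totalModel E) 𝓘(ℝ, E) ∞ proj
  proj_mem : ∀ p, proj p ∈ U
  proj_smul : ∀ (z : Circle) (p : P), proj (z • p) = proj p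
  /-- smooth equivariant local trivializations `proj ⁻¹ V ≃ V × T^1` -/
  locally_trivial : ∀ x ∈ U, ∃ t : Bundle.Trivialization Circle proj, x ∈ t.baseSet ∧
    ContMDiffOn (totalModel E) (𝓘(ℝ, E).prod (𝓡 1)) ∞ t t.source ∧
    ContMDiffOn (𝓘(ℝ, E).prod (𝓡 1)) (totalModel E) ∞ t.toOpenPartialHomeomorph.symm t.target ∧
    ∀ (z : Circle), ∀ p ∈ t.source, (t (z • p)).2 = z * (t p).2
  /-- the connection form -/
  conn : DiffForm (totalModel E) P 1
  smooth_conn : conn.SmoothOn univ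
  conn_invariant : ∀ z : Circle, conn.pullback (totalModel E) (fun p : P => z • p) = conn
  conn_vertical : ∀ p : P, conn p (fun _ => mfderiv 𝓘(ℝ, ℝ) (totalModel E)
    (fun t : ℝ => Circle.exp (2 * Real.pi * t) • p) 0 (1 : ℝ)) = 1
  curvature : conn.IsExtDerivOn (Ω.pullback (totalModel E) proj) univ

attribute [instance] CircleBundle.top CircleBundle.charted CircleBundle.manifold
  CircleBundle.action

/-- The total space of the restriction of a circle bundle to `V`. -/
def CircleBundle.over {Ω : DiffForm 𝓘(ℝ, E) N 2} {U : Opens N} (e : CircleBundle Ω U)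
    (V : Opens N) : Opens e.P :=
  ⟨e.proj ⁻¹' V, V.isOpen.preimage e.smooth_proj.continuous⟩

/-- The morphisms over `V` between (the restrictions to `V` of) two objects of `C(Ω)`: smooth
equivariant maps over the identity of `V` that pull the second connection back to the first. -/
structure CircleHom {Ω : DiffForm 𝓘(ℝ, E) N 2} {U U' : Opens N} (e : CircleBundle Ω U)
    (e' : CircleBundle Ω U') (V : Opens N) where
  toFun : e.over V → e'.P
  smooth : ContMDiff (totalModel E) (totalModel E) ∞ toFun
  proj_eq : ∀ p, e'.proj (toFun p) = e.proj p
  equivariant : ∀ (z : Circle) (p q : e.over V), (q : e.P) = z • (p : e.P) →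
    toFun q = z • toFun p
  conn_eq : e'.conn.pullback (totalModel E) toFun =
    e.conn.pullback (totalModel E) (Subtype.val : e.over V → e.P)

/-- `c` is the classifying cocycle of `C(Ω)` for some choice of objects `e i` over `U i` and of
morphisms `g i j : e j → e i` over `U i ∩ U j`:
on triple intersections, `g i j ∘ g j k = c i j k ∘ g i k`, where the locally constant function
`c i j k` with values in `T^1` acts as an automorphism. -/
def IsCircleClassifying (Ω : DiffForm 𝓘(ℝ, E) N 2) {I : Type w} (U : I → Opens N)
    (c : CechCochain U T1 2) : Prop :=
  ∃ (e : ∀ i, CircleBundle Ω (U i)) (g : ∀ i j, CircleHom (e j) (e i) (U i ⊓ U j)),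
    ∀ (s : Fin 3 → I) (p : (e (s 2)).P) (hp : (e (s 2)).proj p ∈ overlap U s)
      (q : (e (s 1)).P) (hq : q = (g (s 1) (s 2)).toFun
        ⟨p, overlap_le U s 1 hp, overlap_le U s 2 hp⟩),
      (g (s 0) (s 1)).toFun ⟨q, by
          subst hq
          change (e (s 1)).proj _ ∈ U (s 0) ⊓ U (s 1)
          rw [(g (s 1) (s 2)).proj_eq]
          exact ⟨overlap_le U s 0 hp, overlap_le U s 1 hp⟩⟩ =
        Additive.toMul (c s ⟨(e (s 2)).proj p, hp⟩) •
          (g (s 0) (s 2)).toFun ⟨p, overlap_le U s 0 hp, overlap_le U s 2 hp⟩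

/-- Given the notion "`c` is a classifying cocycle, for the open cover `U`, of a gerbe with band
the locally constant `A`-valued functions", `h` is the class of the classifying cocycle of the
gerbe: there are such cocycles, and each of them is a Čech cocycle with class `h`. -/
def IsClassOf {A : Type*} [AddCommGroup A]
    (R : ∀ {I : Type u} (U : I → Opens N), CechCochain U A 2 → Prop) (h : CechH N A 2) : Prop :=
  (∃ (I : Type u) (U : I → Opens N) (c : CechCochain U A 2), (∀ x, ∃ i, x ∈ U i) ∧ R U c) ∧
  ∀ (I : Type u) (U : I → Opens N) (c : CechCochain U A 2) (hU : ∀ x, ∃ i, x ∈ U i), R U c →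
    ∃ hc : c ∈ CechCocycle U A 2, cechClass U hU 2 ⟨c, hc⟩ = h

end Gerbes

end

/-! The long exact sequence. Composing a locally constant function with any map of sets gives a
locally constant function. Hence `0 → ℤ → ℝ → T^1 → 1` is exact on cochains of every family of open
sets, without refinement, and the usual diagram chase applies. It is carried out in the colimit:
`ConnectingRel` relates the class of `g` to that of `m` when some cochain `r` lifts `g` and `dr`
comes from `m`. This relation is additive, everywhere defined and single-valued, so it is the graph
of the connecting homomorphism.

From `C'(Ω)` to `C(Ω)`. A potential `α` gives the trivial bundle `U × T^1` with connection form `α +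
dθ / 2π`, and a function `u` with `du = α - α'` gives multiplication by `exp (2πi u)`. Composition
is respected, so a classifying cocycle `c` goes to `exp (2πi c)` on the same cover. This is the
third claim (`IsRClassifying.isCircleClassifying`).

Independence of choices. Both notions of classifying cocycle are weakened to `IsLocallyClassifying`:
potentials `e i` of `Ω`, and functions `z i j`, locally `φ ∘ u` with `du = e j - e i`, whose
coboundary is `c`. For circle bundles this holds on a finer cover: `e i` is the connection form
pulled back along a local section, and `z i j` compares sections through the morphism `g i j`. On
sets where closed `1`-forms are exact, two such data have `e i - e' i = d(f i)`. Then `z i j - z' i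
j + φ (f i) - φ (f j)` is locally `φ` of a function with zero differential, hence locally constant,
and its coboundary is `c - c'` (`IsLocallyClassifying.sub_mem_boundary`). Such sets form arbitrarily
fine covers, so the classes agree in the colimit.

Existence. The Poincaré lemma for `2`-forms gives local potentials. Good covers are avoided: in a
star refinement, two members that meet lie in one set `Y k` carrying a potential, and comparing both
given potentials with it provides the morphism (`exists_isRClassifying`). One cocycle `c` of `C'(Ω)`
and its exponential then represent the two classes, which settles the second claim. -/

noncomputable section

/-! ### Čech complexes, their colimit over covers, and the long exact sequence -/

section Cech
variable {N : Type u} [TopologicalSpace N] {A B C : Type*} [AddCommGroup A] [AddCommGroup B]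
  [AddCommGroup C]

theorem cechD_apply {I : Type v} (U : I → Opens N) (n : ℕ) (c : CechCochain U A n)
    (s : Fin (n + 2) → I) (x : overlap U s) :
    cechD U A n c s x = ∑ j : Fin (n + 2), (-1 : ℤ) ^ (j : ℕ) •
      c (s ∘ j.succAbove) ⟨x, overlap_face U s j x.2⟩ := by
  have : ∀ (t : Finset (Fin (n + 2))) (F : Fin (n + 2) → LocallyConstant (overlap U s) A),
      (∑ j ∈ t, F j) x = ∑ j ∈ t, F j x := fun t F =>
    map_sum (LocallyConstant.evalAddMonoidHom x) F t
  change (∑ j : Fin (n + 2), (-1 : ℤ) ^ (j : ℕ) • lcRes A (overlap_face U s j)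
    (c (s ∘ j.succAbove))) x = _
  rw [this]
  rfl

theorem cochain_congr {I : Type v} {U : I → Opens N} {n : ℕ} (c : CechCochain U A n)
    {s t : Fin (n + 1) → I} (h : s = t) {x : N} (hs : x ∈ overlap U s) (ht : x ∈ overlap U t) :
    c s ⟨x, hs⟩ = c t ⟨x, ht⟩ := by
  subst h
  rfl

/-- Omitting two indices in either order gives the same face with opposite signs. The involution
`(i, j) ↦ (i.succAbove j, j.predAbove i)` exchanges the two orders and has no fixed point, so the
double sum cancels in pairs. -/
theorem cechD_cechD {I : Type v} (U : I → Opens N) (n : ℕ) (c : CechCochain U A n) :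
    cechD U A (n + 1) (cechD U A n c) = 0 := by
  funext s
  ext x
  rw [cechD_apply]
  simp only [cechD_apply, Finset.smul_sum, smul_smul, ← pow_add]
  rw [← Finset.sum_product']
  refine Finset.sum_involution (fun p _ => (p.1.succAbove p.2, p.2.predAbove p.1)) ?_ ?_ ?_ ?_
  · rintro ⟨i, j⟩ -
    have h : (s ∘ (i.succAbove j).succAbove) ∘ (j.predAbove i).succAbove
        = (s ∘ i.succAbove) ∘ j.succAbove := by
      funext k
      simp [Fin.succAbove_succAbove_succAbove_predAbove]
    rw [cochain_congr c h _ (overlap_face U _ j (overlap_face U s i x.2)),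
      Fin.neg_one_pow_succAbove_add_predAbove, ← add_smul]
    simp
  · rintro ⟨i, j⟩ - - h
    exact Fin.succAbove_ne i j (congrArg Prod.fst h)
  · simp
  · rintro ⟨i, j⟩ -
    refine Prod.ext (Fin.succAbove_succAbove_predAbove i j) ?_
    ext
    simp only [Fin.succAbove, Fin.predAbove, Fin.lt_def, Fin.val_castSucc, apply_dite Fin.val,
      Fin.val_pred, Fin.coe_castPred, dite_eq_ite, apply_ite Fin.val, Fin.val_succ]
    split_ifs <;> lia

theorem cechBoundary_le {I : Type v} (U : I → Opens N) (n : ℕ) :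
    cechBoundary U A n ≤ CechCocycle U A n := by
  cases n with
  | zero => exact bot_le
  | succ n =>
    rintro _ ⟨b, rfl⟩
    exact cechD_cechD U n b

instance (n : ℕ) : DirectedSystem (fun W : PtCover N => CechHCover W.1 A n)
    (fun _ _ h => hRefine id h A n) where
  map_self W x := by
    obtain ⟨c, rfl⟩ := QuotientAddGroup.mk_surjective x
    rfl
  map_map _ _ _ _ _ x := by
    obtain ⟨c, rfl⟩ := QuotientAddGroup.mk_surjective x
    rfl

instance : Nonempty (PtCover N) := ⟨⟨fun _ => ⊤, fun _ => trivial⟩⟩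

instance : IsDirectedOrder (PtCover N) where
  directed W W' := ⟨⟨fun x => W.1 x ⊓ W'.1 x, fun x => ⟨W.2 x, W'.2 x⟩⟩, fun _ => inf_le_left,
    fun _ => inf_le_right⟩

theorem ptClass_refine {W W' : PtCover N} (h : W ≤ W') (n : ℕ) (c : CechCocycle W.1 A n) :
    ptClass W' n (cocycleRefine id h A n c) = ptClass W n c :=
  AddCommGroup.DirectLimit.of_f (G := fun W : PtCover N => CechHCover W.1 A n)
    (f := fun _ _ h => hRefine id h A n) h (QuotientAddGroup.mk' _ c)

theorem exists_ptClass_eq {n : ℕ} (a : CechH N A n) :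
    ∃ (W : PtCover N) (c : CechCocycle W.1 A n), ptClass W n c = a := by
  refine AddCommGroup.DirectLimit.induction_on (G := fun W : PtCover N => CechHCover W.1 A n)
    (f := fun _ _ h => hRefine id h A n) a fun W x => ?_
  obtain ⟨c, rfl⟩ := QuotientAddGroup.mk_surjective x
  exact ⟨W, c, rfl⟩

theorem ptClass_eq_zero_of_mem {W : PtCover N} {n : ℕ} {c : CechCocycle W.1 A n}
    (h : c.1 ∈ cechBoundary W.1 A n) : ptClass W n c = 0 := by
  have : QuotientAddGroup.mk' ((cechBoundary W.1 A n).addSubgroupOf (CechCocycle W.1 A n)) c = 0 :=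
    (QuotientAddGroup.eq_zero_iff c).2 h
  exact (congrArg (AddCommGroup.DirectLimit.of (fun W : PtCover N => CechHCover W.1 A n)
    (fun _ _ h => hRefine id h A n) W) this).trans (map_zero _)

theorem exists_refine_mem_of_ptClass_eq_zero {W : PtCover N} {n : ℕ} {c : CechCocycle W.1 A n}
    (h : ptClass W n c = 0) : ∃ (W' : PtCover N) (hW : W ≤ W'),
      (cocycleRefine id hW A n c).1 ∈ cechBoundary W'.1 A n := by
  obtain ⟨W', hW, h'⟩ := AddCommGroup.DirectLimit.of.zero_exact
    (G := fun W : PtCover N => CechHCover W.1 A n) (f := fun _ _ h => hRefine id h A n) W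
    (QuotientAddGroup.mk' _ c) h
  exact ⟨W', hW, (QuotientAddGroup.eq_zero_iff (cocycleRefine id hW A n c)).1 h'⟩

theorem cechHMap_ptClass (φ : A →+ B) (n : ℕ) (W : PtCover N) (c : CechCocycle W.1 A n) :
    cechHMap N φ n (ptClass W n c) = ptClass W n (cocycleCoeff W.1 φ n c) :=
  AddCommGroup.DirectLimit.map_apply_of _ _ _

theorem cechHMap_cechClass {I : Type v} (U : I → Opens N) (hU : ∀ x, ∃ i, x ∈ U i) (φ : A →+ B)
    (n : ℕ) (c : CechCocycle U A n) :
    cechHMap N φ n (cechClass U hU n c) = cechClass U hU n (cocycleCoeff U φ n c) :=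
  cechHMap_ptClass φ n _ _

/-! ### The long exact sequence -/

/-- A set-theoretic section of `φ` suffices, since its composite with a locally constant function is
again locally constant. This is why lifts exist on the given family, with no refinement. -/
theorem cechCoeff_surjective {I : Type v} (U : I → Opens N) {φ : A →+ B}
    (hφ : Function.Surjective φ) (n : ℕ) : Function.Surjective (cechCoeff U φ n) := by
  intro c
  refine ⟨fun s => (c s).map (Function.surjInv hφ), ?_⟩
  funext s
  ext x
  exact Function.surjInv_eq hφ _

theorem cechCoeff_injective {I : Type v} (U : I → Opens N) {φ : A →+ B}
    (hφ : Function.Injective φ) (n : ℕ) : Function.Injective (cechCoeff U φ n) := by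
  intro c c' h
  funext s
  ext x
  exact hφ (DFunLike.congr_fun (congrFun h s) x)

theorem exists_cechCoeff_eq {I : Type v} (U : I → Opens N) {φ : A →+ B} {ψ : B →+ C}
    (h : Function.Exact φ ψ) (n : ℕ) (c : CechCochain U B n) (hc : cechCoeff U ψ n c = 0) :
    ∃ a, cechCoeff U φ n a = c := by
  have key : ∀ b, ψ b = 0 → φ (Function.invFun φ b) = b := fun b hb =>
    Function.invFun_eq ((h b).1 hb)
  refine ⟨fun s => (c s).map (Function.invFun φ), ?_⟩
  funext s
  ext x
  exact key _ (DFunLike.congr_fun (congrFun hc s) x)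

theorem cechCoeff_comp_eq_zero {I : Type v} (U : I → Opens N) {φ : A →+ B} {ψ : B →+ C}
    (h : Function.Exact φ ψ) (n : ℕ) (c : CechCochain U A n) :
    cechCoeff U ψ n (cechCoeff U φ n c) = 0 := by
  funext s
  ext x
  exact h.apply_apply_eq_zero _

/-- Lifting a boundary to a boundary allows a lift to be corrected into the kernel of the
coefficient map without changing its differential or its class. In degree `0` the only boundary is
`0`. -/
theorem exists_boundary_cechCoeff_eq {I : Type v} (U : I → Opens N) {φ : A →+ B}
    (hφ : Function.Surjective φ) {n : ℕ} {c : CechCochain U B n} (hc : c ∈ cechBoundary U B n) :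
    ∃ r ∈ cechBoundary U A n, cechCoeff U φ n r = c := by
  cases n with
  | zero => exact ⟨0, zero_mem _, by rw [map_zero, (show c = 0 from hc)]⟩
  | succ n =>
    obtain ⟨b, rfl⟩ := hc
    obtain ⟨r, rfl⟩ := cechCoeff_surjective U hφ n b
    exact ⟨_, ⟨r, rfl⟩, (cechD_cechCoeff U φ n r).symm⟩

theorem cechCoeff_cechRefine {I : Type v} {J : Type w} {U : I → Opens N} {V : J → Opens N}
    (τ : J → I) (h : ∀ j, V j ≤ U (τ j)) (φ : A →+ B) (n : ℕ) (c : CechCochain U A n) :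
    cechCoeff V φ n (cechRefine τ h A n c) = cechRefine τ h B n (cechCoeff U φ n c) := rfl

/-- The class `b` is the image of the class `a` under the connecting homomorphism of
`0 → A → B → C → 0`. -/
def ConnectingRel (i : A →+ B) (p : B →+ C) (n : ℕ) (a : CechH N C n)
    (b : CechH N A (n + 1)) : Prop :=
  ∃ (W : PtCover N) (r : CechCochain W.1 B n) (g : CechCocycle W.1 C n)
    (m : CechCocycle W.1 A (n + 1)),
    cechCoeff W.1 p n r = g ∧ cechCoeff W.1 i (n + 1) m = cechD W.1 B n r ∧
      ptClass W n g = a ∧ ptClass W (n + 1) m = b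

namespace ConnectingRel

variable {i : A →+ B} {p : B →+ C} {n : ℕ}

theorem add {a a' : CechH N C n} {b b' : CechH N A (n + 1)} (h : ConnectingRel i p n a b)
    (h' : ConnectingRel i p n a' b') : ConnectingRel i p n (a + a') (b + b') := by
  obtain ⟨W, r, g, m, h1, h2, rfl, rfl⟩ := h
  obtain ⟨W', r', g', m', h1', h2', rfl, rfl⟩ := h'
  obtain ⟨V, hV, hV'⟩ := exists_ge_ge W W'
  refine ⟨V, cechRefine id hV B n r + cechRefine id hV' B n r',
    cocycleRefine id hV C n g + cocycleRefine id hV' C n g',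
    cocycleRefine id hV A _ m + cocycleRefine id hV' A _ m', ?_, ?_, ?_, ?_⟩
  · rw [map_add, cechCoeff_cechRefine, cechCoeff_cechRefine, h1, h1']
    rfl
  · rw [map_add, cechD_cechRefine, cechD_cechRefine, ← h2, ← h2', AddSubgroup.coe_add, map_add]
    rfl
  · rw [map_add, ptClass_refine, ptClass_refine]
  · rw [map_add, ptClass_refine, ptClass_refine]

theorem neg {a : CechH N C n} {b : CechH N A (n + 1)} (h : ConnectingRel i p n a b) :
    ConnectingRel i p n (-a) (-b) := by
  obtain ⟨W, r, g, m, h1, h2, rfl, rfl⟩ := h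
  exact ⟨W, -r, -g, -m, by simp [h1], by simp [h2], map_neg _ _, map_neg _ _⟩

theorem exists_rel (hi : Function.Injective i) (hp : Function.Surjective p)
    (h : Function.Exact i p) (a : CechH N C n) : ∃ b, ConnectingRel i p n a b := by
  obtain ⟨W, g, rfl⟩ := exists_ptClass_eq a
  obtain ⟨r, hr⟩ := cechCoeff_surjective W.1 hp n g.1
  obtain ⟨m, hm⟩ := exists_cechCoeff_eq W.1 h (n + 1) (cechD W.1 B n r) (by
    rw [← cechD_cechCoeff, hr]
    exact g.2)
  have hm' : m ∈ CechCocycle W.1 A (n + 1) := by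
    apply cechCoeff_injective W.1 hi
    rw [← cechD_cechCoeff, hm, cechD_cechD, map_zero]
  exact ⟨_, W, r, g, ⟨m, hm'⟩, hr, hm, rfl, rfl⟩

/-- On a finer cover `g` is a boundary and lifts to a boundary `q`. Then `r - q` maps to `0`, so it
comes from an `A`-valued cochain `k`; since `dq = 0`, injectivity of `i` gives `dk = m`. -/
theorem eq_zero (hi : Function.Injective i) (hp : Function.Surjective p)
    (h : Function.Exact i p) {b : CechH N A (n + 1)} (hb : ConnectingRel i p n 0 b) : b = 0 := by
  obtain ⟨W, r, g, m, h1, h2, h0, rfl⟩ := hb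
  obtain ⟨V, hV, hg⟩ := exists_refine_mem_of_ptClass_eq_zero h0
  rw [← ptClass_refine hV]
  apply ptClass_eq_zero_of_mem
  obtain ⟨q, hq, hqg⟩ := exists_boundary_cechCoeff_eq V.1 hp hg
  obtain ⟨k, hk⟩ := exists_cechCoeff_eq V.1 h n (cechRefine id hV B n r - q) (by
    rw [map_sub, hqg, cechCoeff_cechRefine, h1]
    exact sub_self _)
  refine ⟨k, cechCoeff_injective V.1 hi _ ?_⟩
  have hq' : cechD V.1 B n q = 0 := cechBoundary_le V.1 n hq
  rw [← cechD_cechCoeff, hk, map_sub, hq', sub_zero, cechD_cechRefine, ← h2]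
  rfl

theorem unique (hi : Function.Injective i) (hp : Function.Surjective p)
    (h : Function.Exact i p) {a : CechH N C n} {b b' : CechH N A (n + 1)}
    (hb : ConnectingRel i p n a b) (hb' : ConnectingRel i p n a b') : b = b' := by
  have := hb.add hb'.neg
  rw [add_neg_cancel] at this
  exact add_neg_eq_zero.1 (this.eq_zero hi hp h)

end ConnectingRel

/-- The connecting homomorphism of `0 → A → B → C → 0`. -/
def connecting {i : A →+ B} {p : B →+ C} (hi : Function.Injective i) (hp : Function.Surjective p)
    (h : Function.Exact i p) (n : ℕ) : CechH N C n →+ CechH N A (n + 1) :=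
  AddMonoidHom.mk' (fun a => (ConnectingRel.exists_rel hi hp h a).choose) fun a a' =>
    ConnectingRel.unique hi hp h (ConnectingRel.exists_rel hi hp h (a + a')).choose_spec
      ((ConnectingRel.exists_rel hi hp h a).choose_spec.add
        (ConnectingRel.exists_rel hi hp h a').choose_spec)

section LongExact

variable {i : A →+ B} {p : B →+ C} (hi : Function.Injective i) (hp : Function.Surjective p)
  (h : Function.Exact i p) (n : ℕ)

theorem connecting_rel (a : CechH N C n) : ConnectingRel i p n a (connecting hi hp h n a) :=
  (ConnectingRel.exists_rel hi hp h a).choose_spec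

theorem connecting_eq {a : CechH N C n} {b : CechH N A (n + 1)} (hb : ConnectingRel i p n a b) :
    connecting hi hp h n a = b :=
  (connecting_rel hi hp h n a).unique hi hp h hb

include hi hp h in
-- If the image of `b` is a boundary on a finer cover, subtracting from `b` a boundary with the same
-- image leaves a cocycle with values in `A`.
theorem cechH_exact_middle : Function.Exact (cechHMap N i n) (cechHMap N p n) := by
  intro b
  constructor
  · intro hb
    obtain ⟨W, b, rfl⟩ := exists_ptClass_eq b
    rw [cechHMap_ptClass] at hb
    obtain ⟨V, hV, hb⟩ := exists_refine_mem_of_ptClass_eq_zero hb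
    obtain ⟨q, hq, hqb⟩ := exists_boundary_cechCoeff_eq V.1 hp hb
    obtain ⟨a, ha⟩ := exists_cechCoeff_eq V.1 h n (cechRefine id hV B n b - q) (by
      rw [map_sub, hqb]
      exact sub_self _)
    have hq' : cechD V.1 B n q = 0 := cechBoundary_le V.1 n hq
    have hb' : cechD W.1 B n b = 0 := b.2
    have ha' : a ∈ CechCocycle V.1 A n := by
      apply cechCoeff_injective V.1 hi
      rw [← cechD_cechCoeff, ha, map_sub, hq', sub_zero, cechD_cechRefine, hb', map_zero, map_zero]
    refine ⟨ptClass V n ⟨a, ha'⟩, ?_⟩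
    rw [cechHMap_ptClass, ← ptClass_refine hV n b, ← sub_eq_zero, ← map_sub]
    apply ptClass_eq_zero_of_mem
    have : (cocycleCoeff V.1 i n ⟨a, ha'⟩ - cocycleRefine id hV B n b).1 = -q := by
      change cechCoeff V.1 i n a - cechRefine id hV B n b = -q
      rw [ha]
      abel
    rw [this]
    exact neg_mem hq
  · rintro ⟨a, rfl⟩
    obtain ⟨W, a, rfl⟩ := exists_ptClass_eq a
    rw [cechHMap_ptClass, cechHMap_ptClass]
    have : cocycleCoeff W.1 p n (cocycleCoeff W.1 i n a) = 0 :=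
      Subtype.ext (cechCoeff_comp_eq_zero W.1 h n a.1)
    rw [this, map_zero]

/-- When `m = dk` on a finer cover, `r - i k` is a cocycle and still lifts `g`. -/
theorem cechH_exact_right :
    Function.Exact (cechHMap N p n) (connecting (N := N) hi hp h n) := by
  intro a
  constructor
  · intro ha
    obtain ⟨W, r, g, m, h1, h2, rfl, hm⟩ := connecting_rel hi hp h n a
    rw [ha] at hm
    obtain ⟨V, hV, k, hk⟩ := exists_refine_mem_of_ptClass_eq_zero hm
    have hk' : cechD V.1 A n k = cechRefine id hV A (n + 1) m := hk
    have hr : cechRefine id hV B n r - cechCoeff V.1 i n k ∈ CechCocycle V.1 B n := by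
      rw [AddMonoidHom.mem_ker, map_sub, cechD_cechCoeff, hk', cechCoeff_cechRefine, h2,
        cechD_cechRefine, sub_self]
    refine ⟨ptClass V n ⟨_, hr⟩, ?_⟩
    rw [cechHMap_ptClass, ← ptClass_refine hV]
    congr 1
    apply Subtype.ext
    change cechCoeff V.1 p n (cechRefine id hV B n r - cechCoeff V.1 i n k) = _
    rw [map_sub, cechCoeff_comp_eq_zero V.1 h, sub_zero, cechCoeff_cechRefine, h1]
    rfl
  · rintro ⟨b, rfl⟩
    obtain ⟨W, b, rfl⟩ := exists_ptClass_eq b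
    refine connecting_eq hi hp h n ⟨W, b, cocycleCoeff W.1 p n b, 0, rfl, ?_,
      (cechHMap_ptClass _ _ _ _).symm, map_zero _⟩
    rw [(show cechD W.1 B n b = 0 from b.2)]
    exact map_zero _

/-- If `i m = dr` on a finer cover, then `p r` is a cocycle, and `r` itself witnesses that its
connecting image is the class of `m`. -/
theorem cechH_exact_left :
    Function.Exact (connecting (N := N) hi hp h n) (cechHMap N i (n + 1)) := by
  intro b
  constructor
  · intro hb
    obtain ⟨W, m, rfl⟩ := exists_ptClass_eq b
    rw [cechHMap_ptClass] at hb
    obtain ⟨V, hV, r, hr⟩ := exists_refine_mem_of_ptClass_eq_zero hb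
    have hr' : cechD V.1 B n r = cechCoeff V.1 i (n + 1) (cocycleRefine id hV A (n + 1) m) := hr
    have hg : cechCoeff V.1 p n r ∈ CechCocycle V.1 C n := by
      rw [AddMonoidHom.mem_ker, cechD_cechCoeff, hr', cechCoeff_comp_eq_zero V.1 h]
    exact ⟨ptClass V n ⟨_, hg⟩, connecting_eq hi hp h n
      ⟨V, r, ⟨_, hg⟩, _, rfl, hr'.symm, rfl, ptClass_refine hV _ m⟩⟩
  · rintro ⟨a, rfl⟩
    obtain ⟨W, r, g, m, h1, h2, -, hm⟩ := connecting_rel hi hp h n a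
    rw [← hm, cechHMap_ptClass]
    exact ptClass_eq_zero_of_mem ⟨r, h2.symm⟩

end LongExact

/-! ### The exponential sequence of coefficient groups -/

theorem intIncl_injective : Function.Injective intIncl := Int.cast_injective

theorem expT1_apply (x : ℝ) : expT1 x = Additive.ofMul (Circle.exp (2 * Real.pi * x)) := rfl

theorem expT1_surjective : Function.Surjective expT1 := by
  intro z
  obtain ⟨t, ht⟩ := Circle.exp_surjective (Additive.toMul z)
  refine ⟨t / (2 * Real.pi), ?_⟩
  rw [expT1_apply, mul_div_cancel₀ _ (by positivity), ht]
  rfl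

theorem intIncl_expT1_exact : Function.Exact intIncl expT1 := by
  intro x
  have : expT1 x = 0 ↔ Circle.exp (2 * Real.pi * x) = 1 := Iff.rfl
  rw [this, Circle.exp_eq_one]
  constructor
  · rintro ⟨k, hk⟩
    refine ⟨k, ?_⟩
    have : (2 * Real.pi) ≠ 0 := by positivity
    exact mul_left_cancel₀ this (by simp only [intIncl, Int.coe_castAddHom]; linarith)
  · rintro ⟨k, rfl⟩
    exact ⟨k, by simp only [intIncl, Int.coe_castAddHom]; ring⟩

theorem exists_connecting_exact : ∃ δ : ∀ n : ℕ, CechH N T1 n →+ CechH N ℤ (n + 1),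
    ∀ n, IsConnecting n (δ n) ∧
      Function.Exact (cechHMap N intIncl n) (cechHMap N expT1 n) ∧
      Function.Exact (cechHMap N expT1 n) (δ n) ∧
      Function.Exact (δ n) (cechHMap N intIncl (n + 1)) :=
  ⟨connecting intIncl_injective expT1_surjective intIncl_expT1_exact, fun n =>
    ⟨fun W r g m h1 h2 => connecting_eq _ _ _ n ⟨W, r, g, m, h1, h2, rfl, rfl⟩,
      cechH_exact_middle intIncl_injective expT1_surjective intIncl_expT1_exact n,
      cechH_exact_right _ _ _ n, cechH_exact_left _ _ _ n⟩⟩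

end Cech

/-! ### Pull-back of differential forms and naturality of the exterior derivative -/

section Forms

variable {E : Type*} [NormedAddCommGroup E] [NormedSpace ℝ E] {H : Type*} [TopologicalSpace H]
  {E' : Type*} [NormedAddCommGroup E'] [NormedSpace ℝ E'] {H' : Type*} [TopologicalSpace H']
  {E'' : Type*} [NormedAddCommGroup E''] [NormedSpace ℝ E''] {H'' : Type*} [TopologicalSpace H'']

namespace DiffForm

variable {J : ModelWithCorners ℝ E H} {M : Type*} [TopologicalSpace M] [ChartedSpace H M]
  {J' : ModelWithCorners ℝ E' H'} {M' : Type*} [TopologicalSpace M'] [ChartedSpace H' M']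
  {J'' : ModelWithCorners ℝ E'' H''} {M'' : Type*} [TopologicalSpace M''] [ChartedSpace H'' M'']
  {k : ℕ}

theorem pullback_apply (f : M → M') (η : DiffForm J' M' k) (x : M)
    (v : Fin k → TangentSpace J x) :
    pullback J f η x v = η (f x) (fun i => mfderiv J J' f x (v i)) := rfl

theorem pullback_congr {f g : M → M'} (η : DiffForm J' M' k) {x : M} (h : f =ᶠ[𝓝 x] g) :
    pullback J f η x = pullback J g η x := by
  -- The tangent spaces at `f x` and `g x` are indexed by different points. Reading both as `E'`
  -- makes the equalities well typed and usable for rewriting.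
  have h1 : mfderiv J J' f x = (mfderiv J J' g x : E →L[ℝ] E') := h.mfderiv_eq
  have h2 : f x = g x := h.self_of_nhds
  have h3 : (η (f x) : E' [⋀^Fin k]→L[ℝ] ℝ) = η (g x) := by rw [h2]
  change ContinuousAlternatingMap.compContinuousLinearMap (η (f x) : E' [⋀^Fin k]→L[ℝ] ℝ)
    (mfderiv J J' f x : E →L[ℝ] E') = ContinuousAlternatingMap.compContinuousLinearMap
    (η (g x) : E' [⋀^Fin k]→L[ℝ] ℝ) (mfderiv J J' g x : E →L[ℝ] E')
  rw [h1, h3]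
  rfl

theorem pullback_comp {f : M → M'} {g : M' → M''} (η : DiffForm J'' M'' k) {x : M}
    (hg : MDifferentiableAt J' J'' g (f x)) (hf : MDifferentiableAt J J' f x) :
    pullback J (g ∘ f) η x = pullback J f (pullback J' g η) x := by
  have := mfderiv_comp x hg hf
  unfold pullback
  rw [this]
  rfl

theorem pullback_id (η : DiffForm J M k) : pullback J id η = η := by
  funext x
  unfold pullback
  rw [mfderiv_id]
  rfl

theorem pullback_eq_of_eq {f : M → M'} {η η' : DiffForm J' M' k} {x : M} (h : η (f x) = η' (f x)) :
    pullback J f η x = pullback J f η' x := by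
  unfold pullback
  rw [h]

theorem pullback_zero (f : M → M') :
    pullback J f (0 : DiffForm J' M' k) = 0 := rfl

theorem inChart_add (α β : DiffForm J M k) (x₀ : M) :
    (α + β).inChart x₀ = α.inChart x₀ + β.inChart x₀ := rfl

theorem inChart_eq_of_eq {α β : DiffForm J M k} {x₀ : M} {y : E}
    (h : α ((extChartAt J x₀).symm y) = β ((extChartAt J x₀).symm y)) :
    α.inChart x₀ y = β.inChart x₀ y := pullback_eq_of_eq h

section Boundaryless

theorem contMDiffAt_extChartAt' [IsManifold J ∞ M] (x₀ : M) {x : M}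
    (hx : x ∈ (extChartAt J x₀).source) : ContMDiffAt J 𝓘(ℝ, E) ∞ (extChartAt J x₀) x :=
  (contMDiffOn_extChartAt (I := J) (x := x₀)).contMDiffAt
    ((chartAt H x₀).open_source.mem_nhds (by simpa using hx))

theorem SmoothOn.add {α β : DiffForm J M k} {V : Set M} (hα : α.SmoothOn V) (hβ : β.SmoothOn V) :
    (α + β).SmoothOn V := fun x₀ => (hα x₀).add (hβ x₀)

theorem SmoothOn.mono {α : DiffForm J M k} {V W : Set M} (hα : α.SmoothOn V) (h : W ⊆ V) :
    α.SmoothOn W := fun x₀ => (hα x₀).mono fun _ hy => ⟨hy.1, h hy.2⟩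

theorem IsExtDerivOn.mono {α : DiffForm J M k} {β : DiffForm J M (k + 1)} {V W : Set M}
    (hα : α.IsExtDerivOn β V) (h : W ⊆ V) : α.IsExtDerivOn β W :=
  fun x₀ y hy => hα x₀ y ⟨hy.1, h hy.2⟩

variable [J.Boundaryless]

theorem isOpen_chartDomain (x₀ : M) {V : Set M} (hV : IsOpen V) : IsOpen (chartDomain J x₀ V) :=
  (continuousOn_extChartAt_symm x₀).isOpen_inter_preimage (isOpen_extChartAt_target x₀) hV

theorem contMDiffAt_extChartAt_symm [IsManifold J ∞ M] (x₀ : M) {y : E}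
    (hy : y ∈ (extChartAt J x₀).target) : ContMDiffAt 𝓘(ℝ, E) J ∞ (extChartAt J x₀).symm y :=
  (contMDiffOn_extChartAt_symm x₀).contMDiffAt ((isOpen_extChartAt_target x₀).mem_nhds hy)

theorem SmoothOn.differentiableAt {α : DiffForm J M k} {V : Set M} (hV : IsOpen V)
    (hα : α.SmoothOn V) (x₀ : M) {y : E} (hy : y ∈ chartDomain J x₀ V) :
    DifferentiableAt ℝ (α.inChart x₀) y :=
  ((hα x₀).contDiffAt ((isOpen_chartDomain x₀ hV).mem_nhds hy)).differentiableAt (by simp)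

theorem IsExtDerivOn.add {α α' : DiffForm J M k} {β β' : DiffForm J M (k + 1)} {V : Set M}
    (hV : IsOpen V) (hs : α.SmoothOn V) (hs' : α'.SmoothOn V) (h : α.IsExtDerivOn β V)
    (h' : α'.IsExtDerivOn β' V) : (α + α').IsExtDerivOn (β + β') V := fun x₀ y hy => by
  rw [inChart_add, extDeriv_add (hs.differentiableAt hV x₀ hy) (hs'.differentiableAt hV x₀ hy),
    h x₀ y hy, h' x₀ y hy]
  rfl

theorem IsExtDerivOn.congr {α α' : DiffForm J M k} {β β' : DiffForm J M (k + 1)} {V : Set M}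
    (hV : IsOpen V) (hα : α.IsExtDerivOn β V) (h : ∀ x ∈ V, α' x = α x)
    (h' : ∀ x ∈ V, β' x = β x) : α'.IsExtDerivOn β' V := fun x₀ y hy => by
  have : α'.inChart x₀ =ᶠ[𝓝 y] α.inChart x₀ := by
    filter_upwards [(isOpen_chartDomain x₀ hV).mem_nhds hy] with z hz
    exact inChart_eq_of_eq (h _ hz.2)
  rw [this.extDeriv_eq, hα x₀ y hy]
  exact (inChart_eq_of_eq (h' _ hy.2)).symm

variable [J'.Boundaryless] [IsManifold J ∞ M] [IsManifold J' ∞ M']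

/-- Near the point, `f` composed with the inverse chart at `x₀` equals the inverse chart at `x₁`
composed with the coordinate expression of `f`; functoriality of pull-back then gives the formula.
Smoothness and exterior derivatives of pull-backs are thereby reduced to normed spaces. -/
theorem inChart_pullback {f : M → M'} {x₀ : M} {x₁ : M'} {y : E}
    (hy : y ∈ (extChartAt J x₀).target)
    (hf : ∀ᶠ x in 𝓝 ((extChartAt J x₀).symm y), ContMDiffAt J J' ∞ f x)
    (hx₁ : f ((extChartAt J x₀).symm y) ∈ (extChartAt J' x₁).source) :
    ContDiffAt ℝ ∞ (extChartAt J' x₁ ∘ f ∘ (extChartAt J x₀).symm) y ∧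
    ∀ η : DiffForm J' M' k, (pullback J f η).inChart x₀ =ᶠ[𝓝 y]
      fun z => (η.inChart x₁ ((extChartAt J' x₁ ∘ f ∘ (extChartAt J x₀).symm) z)
        ).compContinuousLinearMap (fderiv ℝ (extChartAt J' x₁ ∘ f ∘ (extChartAt J x₀).symm) z) := by
  have hφ := contMDiffAt_extChartAt_symm (J := J) x₀ hy
  have h1 : ∀ᶠ z in 𝓝 y, z ∈ (extChartAt J x₀).target ∧
      ContMDiffAt J J' ∞ f ((extChartAt J x₀).symm z) ∧
      f ((extChartAt J x₀).symm z) ∈ (extChartAt J' x₁).source := by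
    refine Filter.Eventually.and ((isOpen_extChartAt_target x₀).mem_nhds hy)
      ((hφ.continuousAt.eventually hf).and ?_)
    exact (hf.self_of_nhds.continuousAt.comp hφ.continuousAt).eventually
      ((isOpen_extChartAt_source x₁).mem_nhds hx₁)
  have h2 : ∀ z, z ∈ (extChartAt J x₀).target → ContMDiffAt J J' ∞ f ((extChartAt J x₀).symm z) →
      f ((extChartAt J x₀).symm z) ∈ (extChartAt J' x₁).source →
      ContMDiffAt 𝓘(ℝ, E) 𝓘(ℝ, E') ∞ (extChartAt J' x₁ ∘ f ∘ (extChartAt J x₀).symm) z :=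
    fun z hz hfz hzs => (contMDiffAt_extChartAt' x₁ hzs).comp z
      (hfz.comp z (contMDiffAt_extChartAt_symm x₀ hz))
  refine ⟨(h2 y hy hf.self_of_nhds hx₁).contDiffAt, fun η => ?_⟩
  filter_upwards [eventually_eventually_nhds.2 h1] with z hz
  obtain ⟨hz1, hz2, hz3⟩ := hz.self_of_nhds
  have hφz := (contMDiffAt_extChartAt_symm (J := J) x₀ hz1).mdifferentiableAt (by simp)
  have hFz := (h2 z hz1 hz2 hz3).mdifferentiableAt (by simp)
  have e1 := pullback_comp (J := 𝓘(ℝ, E)) η (hz2.mdifferentiableAt (by simp)) hφz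
  have e2 : f ∘ (extChartAt J x₀).symm =ᶠ[𝓝 z]
      (extChartAt J' x₁).symm ∘ (extChartAt J' x₁ ∘ f ∘ (extChartAt J x₀).symm) := by
    filter_upwards [hz] with z' hz'
    exact ((extChartAt J' x₁).left_inv hz'.2.2).symm
  have hψ : MDifferentiableAt 𝓘(ℝ, E') J' (extChartAt J' x₁).symm
      ((extChartAt J' x₁ ∘ f ∘ (extChartAt J x₀).symm) z) :=
    (contMDiffAt_extChartAt_symm x₁ ((extChartAt J' x₁).map_source hz3)).mdifferentiableAt
      (by simp)
  have e3 := pullback_comp (J := 𝓘(ℝ, E)) η hψ hFz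
  change pullback 𝓘(ℝ, E) (extChartAt J x₀).symm (pullback J f η) z = _
  rw [← e1, pullback_congr η e2, e3]
  change ContinuousAlternatingMap.compContinuousLinearMap _ (mfderiv _ _ _ _) = _
  rw [mfderiv_eq_fderiv]
  rfl

/-- Alternating `1`-forms are isometric to continuous linear functionals, and under this isometry
the operation becomes composition of continuous linear maps, which is smooth in both arguments. -/
theorem _root_.ContDiffAt.compContinuousLinearMap_fin_one {F : Type*} [NormedAddCommGroup F]
    [NormedSpace ℝ F] {a : F → E' [⋀^Fin 1]→L[ℝ] ℝ} {L : F → E →L[ℝ] E'} {y : F}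
    (ha : ContDiffAt ℝ ∞ a y) (hL : ContDiffAt ℝ ∞ L y) :
    ContDiffAt ℝ ∞ (fun z => (a z).compContinuousLinearMap (L z)) y := by
  let Φ' : (E' →L[ℝ] ℝ) ≃ₗᵢ[ℝ] (E' [⋀^Fin 1]→L[ℝ] ℝ) :=
    ContinuousAlternatingMap.ofSubsingletonLIE (0 : Fin 1)
  let Φ : (E →L[ℝ] ℝ) ≃ₗᵢ[ℝ] (E [⋀^Fin 1]→L[ℝ] ℝ) :=
    ContinuousAlternatingMap.ofSubsingletonLIE (0 : Fin 1)
  have h1 := Φ'.symm.contDiff.contDiffAt.comp y ha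
  refine (Φ.contDiff.contDiffAt.comp y (h1.clm_comp hL)).congr_of_eventuallyEq
    (Filter.Eventually.of_forall fun z => ?_)
  obtain ⟨b, hb⟩ := Φ'.surjective (a z)
  change (a z).compContinuousLinearMap (L z) = Φ ((Φ'.symm (a z)).comp (L z))
  rw [← hb, Φ'.symm_apply_apply]
  rfl

theorem SmoothOn.pullback {f : M → M'} {V : Set M} {V' : Set M'} (hV : IsOpen V) (hV' : IsOpen V')
    (hf : ContMDiffOn J J' ∞ f V) (hm : MapsTo f V V') {η : DiffForm J' M' 1}
    (hη : η.SmoothOn V') : (pullback J f η).SmoothOn V := by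
  intro x₀ y hy
  have hf' : ∀ᶠ x in 𝓝 ((extChartAt J x₀).symm y), ContMDiffAt J J' ∞ f x := by
    filter_upwards [hV.mem_nhds hy.2] with x hx using hf.contMDiffAt (hV.mem_nhds hx)
  have hs := mem_extChartAt_source (I := J') (f ((extChartAt J x₀).symm y))
  obtain ⟨h1, h2⟩ := inChart_pullback (k := 1) hy.1 hf' hs
  refine ContDiffAt.contDiffWithinAt (ContDiffAt.congr_of_eventuallyEq ?_ (h2 η))
  refine ContDiffAt.compContinuousLinearMap_fin_one ?_ (h1.fderiv_right (by simp))
  refine ContDiffAt.comp y ((hη _).contDiffAt ((isOpen_chartDomain _ hV').mem_nhds ⟨?_, ?_⟩)) h1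
  · exact (extChartAt J' _).map_source hs
  · simp only [mem_preimage, Function.comp_apply]
    rw [(extChartAt J' _).left_inv hs]
    exact hm hy.2

theorem IsExtDerivOn.pullback {f : M → M'} {V : Set M} {V' : Set M'} (hV : IsOpen V)
    (hV' : IsOpen V') (hf : ContMDiffOn J J' ∞ f V) (hm : MapsTo f V V') {η : DiffForm J' M' k}
    {ξ : DiffForm J' M' (k + 1)} (hη : η.SmoothOn V') (h : η.IsExtDerivOn ξ V') :
    (pullback J f η).IsExtDerivOn (pullback J f ξ) V := by
  intro x₀ y hy
  have hf' : ∀ᶠ x in 𝓝 ((extChartAt J x₀).symm y), ContMDiffAt J J' ∞ f x := by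
    filter_upwards [hV.mem_nhds hy.2] with x hx using hf.contMDiffAt (hV.mem_nhds hx)
  have hs := mem_extChartAt_source (I := J') (f ((extChartAt J x₀).symm y))
  obtain ⟨h1, h2⟩ := inChart_pullback (k := k) hy.1 hf' hs
  have h3 := (inChart_pullback (k := k + 1) hy.1 hf' hs).2 ξ
  have hd : (extChartAt J' (f ((extChartAt J x₀).symm y)) ∘ f ∘ (extChartAt J x₀).symm) y ∈
      chartDomain J' (f ((extChartAt J x₀).symm y)) V' := by
    refine ⟨(extChartAt J' _).map_source hs, ?_⟩
    simp only [mem_preimage, Function.comp_apply]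
    rw [(extChartAt J' _).left_inv hs]
    exact hm hy.2
  rw [(h2 η).extDeriv_eq, h3.self_of_nhds,
    extDeriv_pullback (hη.differentiableAt hV' _ hd) h1
      (by simpa using WithTop.coe_le_coe.2 (le_top (a := (2 : ℕ∞)))), h _ _ hd]

end Boundaryless

theorem inChart_self (α : DiffForm 𝓘(ℝ, E) E k) (x₀ : E) : α.inChart x₀ = α := by
  have : (extChartAt 𝓘(ℝ, E) x₀).symm = PartialEquiv.refl E := by
    rw [extChartAt_model_space_eq_id]; rfl
  rw [inChart, this]
  exact pullback_id α

theorem smoothOn_self_iff {α : DiffForm 𝓘(ℝ, E) E k} {V : Set E} :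
    α.SmoothOn V ↔ ContDiffOn ℝ ∞ (F := E [⋀^Fin k]→L[ℝ] ℝ) α V := by
  have : ∀ x₀, chartDomain 𝓘(ℝ, E) x₀ V = V := fun x₀ => by
    rw [chartDomain, extChartAt_model_space_eq_id]; simp
  simp only [SmoothOn, inChart_self, this]
  exact ⟨fun h => h 0, fun h _ => h⟩

theorem isExtDerivOn_self_iff {α : DiffForm 𝓘(ℝ, E) E k} {β : DiffForm 𝓘(ℝ, E) E (k + 1)}
    {V : Set E} : α.IsExtDerivOn β V ↔
      ∀ y ∈ V, extDeriv (F := ℝ) (E := E) α y = β y := by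
  have : ∀ x₀, chartDomain 𝓘(ℝ, E) x₀ V = V := fun x₀ => by
    rw [chartDomain, extChartAt_model_space_eq_id]; simp
  simp only [IsExtDerivOn, inChart_self, this]
  exact ⟨fun h => h 0, fun h _ => h⟩

end DiffForm
end Forms

/-! ### The Poincaré lemma in normed spaces, for forms of degree `2` and `1` -/

section Poincare

open ContinuousAlternatingMap in
-- Differentiation under the integral sign. The dominating constant comes from compactness of the
-- product of a closed ball with `[0, 1]`, which is where finite dimension enters.
theorem hasFDerivAt_intervalIntegral_of_contDiff {E : Type*} [NormedAddCommGroup E]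
    [NormedSpace ℝ E] [FiniteDimensional ℝ E] {G : Type*} [NormedAddCommGroup G] [NormedSpace ℝ G]
    {F : E × ℝ → G} (hF : ContDiff ℝ 1 F) (x : E) :
    HasFDerivAt (fun x => ∫ t in (0 : ℝ)..1, F (x, t))
      (∫ t in (0 : ℝ)..1, (fderiv ℝ F (x, t)).comp (ContinuousLinearMap.inl ℝ E ℝ)) x := by
  have hc : Continuous fun q : E × ℝ => (fderiv ℝ F q).comp (ContinuousLinearMap.inl ℝ E ℝ) :=
    (hF.continuous_fderiv one_ne_zero).clm_comp continuous_const
  have hpr : ∀ y : E, Continuous fun t : ℝ => (y, t) := fun y => by fun_prop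
  obtain ⟨C, hC⟩ := ((isCompact_closedBall x 1).prod (isCompact_Icc (a := (0 : ℝ)) (b := 1))
    ).exists_bound_of_continuousOn hc.continuousOn
  refine intervalIntegral.hasFDerivAt_integral_of_dominated_of_fderiv_le
    (F := fun x t => F (x, t))
    (F' := fun x t => (fderiv ℝ F (x, t)).comp (ContinuousLinearMap.inl ℝ E ℝ))
    (bound := fun _ => C)
    (Metric.closedBall_mem_nhds x one_pos) ?_ ?_ ?_ ?_ ?_ ?_
  · exact Filter.Eventually.of_forall fun y =>
      (hF.continuous.comp (hpr y)).aestronglyMeasurable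
  · exact (hF.continuous.comp (hpr x)).intervalIntegrable _ _
  · exact (hc.comp (hpr x)).aestronglyMeasurable
  · refine Filter.Eventually.of_forall fun t ht y hy => hC (y, t) ⟨hy, ?_⟩
    rw [uIoc_of_le zero_le_one] at ht
    exact ⟨ht.1.le, ht.2⟩
  · exact intervalIntegrable_const
  · refine Filter.Eventually.of_forall fun t _ y _ => ?_
    have h := ((hF.differentiable one_ne_zero) (y, t)).hasFDerivAt
    exact h.comp y (hasFDerivAt_prodMk_left y t)

/-- The derivative is an integral of the same kind with values in `E →L[ℝ] G`, so the induction on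
the order of differentiability has to vary `G`; one common universe makes this possible. -/
theorem contDiff_intervalIntegral {E G : Type u} [NormedAddCommGroup E]
    [NormedSpace ℝ E] [FiniteDimensional ℝ E] [NormedAddCommGroup G] [NormedSpace ℝ G]
    {F : E × ℝ → G} (hF : ContDiff ℝ ∞ F) :
    ContDiff ℝ ∞ (fun x => ∫ t in (0 : ℝ)..1, F (x, t)) := by
  rw [contDiff_infty]
  intro n
  induction n generalizing G with
  | zero =>
    exact contDiff_zero.2 (continuous_iff_continuousAt.2 fun x =>
      (hasFDerivAt_intervalIntegral_of_contDiff (hF.of_le (by simp)) x).continuousAt)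
  | succ n ih =>
    have h := hasFDerivAt_intervalIntegral_of_contDiff (hF.of_le (by simp))
    push_cast
    rw [contDiff_succ_iff_fderiv]
    refine ⟨fun x => (h x).differentiableAt, by simp, ?_⟩
    have : fderiv ℝ (fun x => ∫ t in (0 : ℝ)..1, F (x, t)) = fun x =>
        ∫ t in (0 : ℝ)..1, (fderiv ℝ F (x, t)).comp (ContinuousLinearMap.inl ℝ E ℝ) :=
      funext fun x => (h x).fderiv
    rw [this]
    exact ih (F := fun q => (fderiv ℝ F q).comp (ContinuousLinearMap.inl ℝ E ℝ))
      ((hF.fderiv_right (by simp)).clm_comp contDiff_const)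

/-- Product rule for the integrand of the homotopy operator. There `Φ` is contraction `a ↦ (v ↦ ι_v
a)`; an abstract bilinear map keeps alternating maps out of the computation. -/
theorem hasFDerivAt_smul_clm_apply_sub {E : Type*} [NormedAddCommGroup E] [NormedSpace ℝ E]
    {A B : Type*} [NormedAddCommGroup A] [NormedSpace ℝ A]
    [NormedAddCommGroup B] [NormedSpace ℝ B] (Φ : A →L[ℝ] E →L[ℝ] B) (c : E) (t : ℝ) {f : E → A}
    {f' : E →L[ℝ] A} {x : E} (hf : HasFDerivAt f f' x) :
    HasFDerivAt (fun x => t • Φ (f x) (x - c)) (t • (Φ (f x) + (Φ.flip (x - c)).comp f')) x := by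
  have h := ((Φ.hasFDerivAt.comp x hf).clm_apply ((hasFDerivAt_id x).sub_const c)).const_smul t
  refine h.congr_fderiv ?_
  apply ContinuousLinearMap.ext
  intro v
  simp

open ContinuousAlternatingMap in
theorem alternatizeUncurryFin_two_apply {E : Type*} [NormedAddCommGroup E] [NormedSpace ℝ E]
    (f : E →L[ℝ] E [⋀^Fin 1]→L[ℝ] ℝ) (v : Fin 2 → E) :
    alternatizeUncurryFin f v = f (v 0) ![v 1] - f (v 1) ![v 0] := by
  have h0 : Fin.removeNth 0 v = ![v 1] := by ext i; fin_cases i; rfl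
  have h1 : Fin.removeNth 1 v = ![v 0] := by ext i; fin_cases i; rfl
  rw [alternatizeUncurryFin_apply, Fin.sum_univ_two, h0, h1]
  simp [sub_eq_add_neg]

open ContinuousAlternatingMap in
theorem alternatizeUncurryFin_three_apply {E : Type*} [NormedAddCommGroup E] [NormedSpace ℝ E]
    (f : E →L[ℝ] E [⋀^Fin 2]→L[ℝ] ℝ) (a b c : E) :
    alternatizeUncurryFin f ![a, b, c] = f a ![b, c] - f b ![a, c] + f c ![a, b] := by
  have h0 : Fin.removeNth 0 ![a, b, c] = ![b, c] := by ext i; fin_cases i <;> rfl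
  have h1 : Fin.removeNth 1 ![a, b, c] = ![a, c] := by ext i; fin_cases i <;> rfl
  have h2 : Fin.removeNth 2 ![a, b, c] = ![a, b] := by ext i; fin_cases i <;> rfl
  rw [alternatizeUncurryFin_apply, Fin.sum_univ_three, h0, h1, h2]
  simp [sub_eq_add_neg]

open ContinuousAlternatingMap in
-- Cartan's formula for the contraction `h_t x = c + t (x - c)`: the pull-back of a `2`-form along
-- `h_t` is `t² η (h_t x)`, and for closed `η` its `t`-derivative is `d` of the contracted form `t
-- ι_{x-c} η (h_t x)`.
theorem extDeriv_homotopy_integrand {E : Type*} [NormedAddCommGroup E] [NormedSpace ℝ E]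
    {η : E → E [⋀^Fin 2]→L[ℝ] ℝ} {c x : E} {t : ℝ}
    (hη : DifferentiableAt ℝ η (c + t • (x - c))) (hd : extDeriv η (c + t • (x - c)) = 0) :
    HasDerivAt (fun t => t ^ 2 • η (c + t • (x - c)))
      (extDeriv (fun x => t • (η (c + t • (x - c))).curryLeft (x - c)) x) t := by
  set p := c + t • (x - c) with hp
  set W := fderiv ℝ η p with hW
  have h1 : HasDerivAt (fun t : ℝ => c + t • (x - c)) (x - c) t := by
    simpa using ((hasDerivAt_id t).smul_const (x - c)).const_add c
  have h2 : HasDerivAt (fun t : ℝ => η (c + t • (x - c))) (W (x - c)) t :=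
    hη.hasFDerivAt.comp_hasDerivAt t h1
  have h3 := ((hasDerivAt_pow 2 t).smul h2)
  have h4 : HasFDerivAt (fun x => c + t • (x - c)) (t • ContinuousLinearMap.id ℝ E) x := by
    simpa using (((hasFDerivAt_id x).sub_const c).const_smul t).const_add c
  have h5 : HasFDerivAt (fun x => η (c + t • (x - c))) (W.comp (t • ContinuousLinearMap.id ℝ E)) x :=
    HasFDerivAt.comp x hη.hasFDerivAt h4
  have h7 := hasFDerivAt_smul_clm_apply_sub
    (curryLeftLI (𝕜 := ℝ) (E := E) (F := ℝ) (n := 1)).toContinuousLinearMap c t h5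
  refine h3.congr_deriv (Eq.symm ?_)
  have h8 : fderiv ℝ (fun x => t • (η (c + t • (x - c))).curryLeft (x - c)) x = _ := h7.fderiv
  rw [extDeriv, h8]
  rw [extDeriv, ← hW] at hd
  rw [← hp]
  clear h8 h7 h5 h4 h3 h2 h1
  clear_value W p
  generalize x - c = y
  ext v
  -- Closedness evaluated on the radial vector `y` and the two arguments. It expresses the
  -- derivative of `η` along `y` through its derivatives along `v 0` and `v 1`.
  have h9 := congrArg (fun a => a ![y, v 0, v 1]) hd
  have h10 : η p ![v 1, v 0] = - η p ![v 0, v 1] := by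
    have := (η p).map_swap ![v 0, v 1] (zero_ne_one (α := Fin 2))
    refine Eq.trans (congrArg (η p) ?_) this
    ext i; fin_cases i <;> rfl
  have h11 : ![v 0, v 1] = v := by ext i; fin_cases i <;> rfl
  rw [alternatizeUncurryFin_three_apply, h11] at h9
  have h12 : W y v - W (v 0) ![y, v 1] + W (v 1) ![y, v 0] = 0 := h9
  simp only [alternatizeUncurryFin_two_apply, _root_.smul_apply, _root_.add_apply,
    ContinuousLinearMap.comp_apply, ContinuousLinearMap.flip_apply, ContinuousLinearMap.id_apply,
    map_smul]
  change t * (η p ![v 0, v 1] + t * W (v 0) ![y, v 1]) -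
    t * (η p ![v 1, v 0] + t * W (v 1) ![y, v 0]) = t ^ 2 * W y v + (2 * t ^ 1) * η p v
  rw [h10, h11]
  linear_combination (-t ^ 2) * h12

theorem contDiff_smul_clm_apply_sub {E : Type*} [NormedAddCommGroup E] [NormedSpace ℝ E]
    {A B : Type*} [NormedAddCommGroup A] [NormedSpace ℝ A]
    [NormedAddCommGroup B] [NormedSpace ℝ B] (Φ : A →L[ℝ] E →L[ℝ] B) (c : E) {f : E × ℝ → A}
    (hf : ContDiff ℝ ∞ f) : ContDiff ℝ ∞ fun q : E × ℝ => q.2 • Φ (f q) (q.1 - c) :=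
  contDiff_snd.smul ((Φ.contDiff.comp hf).clm_apply (contDiff_fst.sub contDiff_const))

/-- With `A` the alternatization, the left side is the exterior derivative of an integral of forms.
`A` passes under the integral, and the fundamental theorem of calculus evaluates it. -/
theorem clm_fderiv_intervalIntegral {E : Type*} [NormedAddCommGroup E] [NormedSpace ℝ E]
    [FiniteDimensional ℝ E] {G G' : Type*} [NormedAddCommGroup G] [NormedSpace ℝ G]
    [CompleteSpace G] [NormedAddCommGroup G'] [NormedSpace ℝ G'] [CompleteSpace G']
    (A : (E →L[ℝ] G) →L[ℝ] G') {F : E × ℝ → G} {p : ℝ → G'} (hF : ContDiff ℝ 1 F) (x : E)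
    (h : ∀ t ∈ Icc (0 : ℝ) 1, HasDerivAt p (A (fderiv ℝ (fun x => F (x, t)) x)) t) :
    A (fderiv ℝ (fun x => ∫ t in (0 : ℝ)..1, F (x, t)) x) = p 1 - p 0 := by
  have hc : Continuous fun t : ℝ => (fderiv ℝ F (x, t)).comp (ContinuousLinearMap.inl ℝ E ℝ) :=
    ((hF.continuous_fderiv one_ne_zero).comp (by fun_prop)).clm_comp continuous_const
  have h1 : ∀ t, fderiv ℝ (fun x => F (x, t)) x =
      (fderiv ℝ F (x, t)).comp (ContinuousLinearMap.inl ℝ E ℝ) := fun t =>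
    (((hF.differentiable one_ne_zero) (x, t)).hasFDerivAt.comp x
      (hasFDerivAt_prodMk_left x t)).fderiv
  simp only [h1] at h
  rw [(hasFDerivAt_intervalIntegral_of_contDiff hF x).fderiv,
    ← A.intervalIntegral_comp_comm (hc.intervalIntegrable _ _)]
  refine intervalIntegral.integral_eq_sub_of_hasDerivAt (fun t ht => h t ?_)
    ((A.continuous.comp hc).intervalIntegrable _ _)
  rwa [uIcc_of_le zero_le_one] at ht

/-- The Poincaré lemma for `2`-forms. -/
theorem exists_contDiffOn_extDeriv_eq {E : Type u} [NormedAddCommGroup E] [NormedSpace ℝ E]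
    [FiniteDimensional ℝ E] {η : E → E [⋀^Fin 2]→L[ℝ] ℝ} {c : E} {r : ℝ} (hr : 0 < r)
    (hη : ContDiffOn ℝ ∞ η (Metric.ball c r)) (hd : ∀ x ∈ Metric.ball c r, extDeriv η x = 0) :
    ∃ (β : E → E [⋀^Fin 1]→L[ℝ] ℝ) (ε : ℝ), 0 < ε ∧ ε ≤ r ∧ ContDiff ℝ ∞ β ∧
      ∀ x ∈ Metric.ball c ε, extDeriv β x = η x := by
  -- The cut-off makes `ζ = χ η` smooth on all of `E`, as the integral lemmas require. It leaves `η`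
  -- unchanged on the ball of radius `r / 3`, which contains the segment from `c` to each of its
  -- points; hence `ε = r / 3`.
  let χ : ContDiffBump c := ⟨r / 3, r / 2, by positivity, by linarith⟩
  let ζ : E → E [⋀^Fin 2]→L[ℝ] ℝ := fun x => χ x • η x
  have hζ : ContDiff ℝ ∞ ζ := by
    rw [contDiff_iff_contDiffAt]
    intro x
    by_cases hx : x ∈ Metric.ball c r
    · exact χ.contDiffAt.smul (hη.contDiffAt (Metric.isOpen_ball.mem_nhds hx))
    · have hx' : x ∈ (tsupport χ)ᶜ := by
        rw [χ.tsupport_eq]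
        intro h
        rw [Metric.mem_closedBall] at h
        rw [Metric.mem_ball, not_lt] at hx
        have : χ.rOut = r / 2 := rfl
        linarith
      refine contDiffAt_const (c := 0) |>.congr_of_eventuallyEq ?_
      filter_upwards [(isClosed_tsupport χ).isOpen_compl.mem_nhds hx'] with z hz
      change χ z • η z = 0
      rw [image_eq_zero_of_notMem_tsupport hz, zero_smul]
  have hζη : ∀ x ∈ Metric.ball c (r / 3), ζ =ᶠ[𝓝 x] η := by
    intro x hx
    filter_upwards [χ.eventuallyEq_one_of_mem_ball hx] with z hz
    change χ z • η z = η z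
    rw [hz]
    simp
  let F : E × ℝ → E [⋀^Fin 1]→L[ℝ] ℝ := fun q =>
    q.2 • (ζ (c + q.2 • (q.1 - c))).curryLeft (q.1 - c)
  have hF : ContDiff ℝ ∞ F := by
    have h1 : ContDiff ℝ ∞ fun q : E × ℝ => ζ (c + q.2 • (q.1 - c)) := hζ.comp (by fun_prop)
    exact contDiff_smul_clm_apply_sub (ContinuousAlternatingMap.curryLeftLI (𝕜 := ℝ) (E := E)
      (F := ℝ) (n := 1)).toContinuousLinearMap c h1
  refine ⟨fun x => ∫ t in (0 : ℝ)..1, F (x, t), r / 3, by positivity, by linarith,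
    contDiff_intervalIntegral hF, fun x hx => ?_⟩
  have h2 := clm_fderiv_intervalIntegral
    (ContinuousAlternatingMap.alternatizeUncurryFinCLM (n := 1) ℝ E ℝ)
    (p := fun t => t ^ 2 • ζ (c + t • (x - c))) (hF.of_le (by simp)) x (by
      intro t ht
      have hp : c + t • (x - c) ∈ Metric.ball c (r / 3) := by
        rw [Metric.mem_ball, dist_eq_norm] at hx ⊢
        rw [add_sub_cancel_left, norm_smul, Real.norm_of_nonneg ht.1]
        exact (mul_le_of_le_one_left (norm_nonneg _) ht.2).trans_lt hx
      exact extDeriv_homotopy_integrand (η := ζ) (c := c) (x := x) (t := t)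
        ((hζ.differentiable (by simp)) _) (by
          rw [(hζη _ hp).extDeriv_eq]
          exact hd _ (Metric.ball_subset_ball (by linarith) hp)))
  -- The difference of endpoint values of `t² ζ (c + t (x - c))` is `ζ x - 0`.
  refine h2.trans ?_
  simpa using (hζη x hx).self_of_nhds

/-- The Poincaré lemma for `1`-forms. -/
theorem exists_contDiffOn_fderiv_eq {E : Type*} [NormedAddCommGroup E] [NormedSpace ℝ E]
    {α : E → E [⋀^Fin 1]→L[ℝ] ℝ} {s : Set E} (hs : Convex ℝ s) (hso : IsOpen s)
    (hα : ContDiffOn ℝ ∞ α s) (hd : ∀ x ∈ s, extDeriv α x = 0) :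
    ∃ f : E → ℝ, ContDiffOn ℝ ∞ f s ∧ ∀ x ∈ s, ∀ v, fderiv ℝ f x v = α x (fun _ => v) := by
  let Φ : (E →L[ℝ] ℝ) ≃ₗᵢ[ℝ] (E [⋀^Fin 1]→L[ℝ] ℝ) :=
    ContinuousAlternatingMap.ofSubsingletonLIE (0 : Fin 1)
  have hΦ : ∀ (a : E [⋀^Fin 1]→L[ℝ] ℝ) v, Φ.symm a v = a (fun _ => v) := fun a v => by
    obtain ⟨b, rfl⟩ := Φ.surjective a
    rw [Φ.symm_apply_apply]
    rfl
  have h1 : ContDiffOn ℝ ∞ (fun x => Φ.symm (α x)) s := Φ.symm.contDiff.comp_contDiffOn hα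
  obtain ⟨f, hf⟩ := hs.exists_forall_hasFDerivAt_of_fderiv_symmetric hso
    (h1.differentiableOn (by simp)) (by
      intro a ha x y
      have h2 : HasFDerivAt α (fderiv ℝ α a) a :=
        ((hα.contDiffAt (hso.mem_nhds ha)).differentiableAt (by simp)).hasFDerivAt
      have h3 : HasFDerivAt (fun x => Φ.symm (α x)) _ a :=
        (Φ.symm.toContinuousLinearEquiv.toContinuousLinearMap.hasFDerivAt (x := α a)).comp a h2
      rw [h3.fderiv]
      -- Closedness evaluated on `x, y` is exactly the symmetry of the derivative that integrability
      -- on a convex set requires.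
      have h4 := congrArg (fun b => b ![x, y]) (hd a ha)
      simp only [extDeriv, alternatizeUncurryFin_two_apply] at h4
      have h5 : fderiv ℝ α a x ![y] - fderiv ℝ α a y ![x] = 0 := h4
      have h6 : ∀ v : E, (fun _ : Fin 1 => v) = ![v] := fun v => by ext i; fin_cases i; rfl
      change Φ.symm (fderiv ℝ α a x) y = Φ.symm (fderiv ℝ α a y) x
      rw [hΦ, hΦ, h6, h6]
      linarith)
  have h2 : ∀ x ∈ s, fderiv ℝ f x = Φ.symm (α x) := fun x hx => (hf x hx).fderiv
  refine ⟨f, ?_, fun x hx v => by rw [h2 x hx, hΦ]⟩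
  rw [contDiffOn_infty_iff_fderiv_of_isOpen hso]
  exact ⟨fun x hx => (hf x hx).differentiableAt.differentiableWithinAt, h1.congr h2⟩

end Poincare

/-! ### Local primitives of closed `1`-forms on a manifold -/

section Primitives

variable {E : Type*} [NormedAddCommGroup E] [NormedSpace ℝ E] {H : Type*} [TopologicalSpace H]
  {J : ModelWithCorners ℝ E H} {M : Type*} [TopologicalSpace M] [ChartedSpace H M]

namespace DiffForm

theorem pullback_extChartAt_inChart [J.Boundaryless] [IsManifold J ∞ M] {k : ℕ}
    (α : DiffForm J M k) (x : M) {y : M} (hy : y ∈ (extChartAt J x).source) :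
    pullback (J' := 𝓘(ℝ, E)) (M' := E) J (extChartAt J x) (α.inChart x) y = α y := by
  have h1 := (contMDiffAt_extChartAt_symm (J := J) x ((extChartAt J x).map_source hy)
    ).mdifferentiableAt (by simp)
  have h2 := (contMDiffAt_extChartAt' (J := J) x hy).mdifferentiableAt (by simp)
  have h3 : (extChartAt J x).symm ∘ extChartAt J x =ᶠ[𝓝 y] id := by
    filter_upwards [(isOpen_extChartAt_source x).mem_nhds hy] with z hz
    exact (extChartAt J x).left_inv hz
  rw [inChart, ← pullback_comp α h1 h2, pullback_congr α h3, pullback_id]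

end DiffForm

/-- `du = α` at the point `x`. -/
def IsPrimitiveAt (u : M → ℝ) (α : DiffForm J M 1) (x : M) : Prop :=
  MDifferentiableAt J 𝓘(ℝ, ℝ) u x ∧
    ∀ v : TangentSpace J x, (mfderiv J 𝓘(ℝ, ℝ) u x v : ℝ) = α x (fun _ => v)

namespace IsPrimitiveAt

variable {u u' : M → ℝ} {α α' : DiffForm J M 1} {x : M}

theorem add (h : IsPrimitiveAt u α x) (h' : IsPrimitiveAt u' α' x) :
    IsPrimitiveAt (u + u') (α + α') x := by
  refine ⟨h.1.add h'.1, fun v => ?_⟩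
  have := mfderiv_add h.1 h'.1
  have h2 := congrArg (fun L : E →L[ℝ] ℝ => L v) this
  exact h2.trans (congrArg₂ (fun a b : ℝ => a + b) (h.2 v) (h'.2 v))

theorem sub (h : IsPrimitiveAt u α x) (h' : IsPrimitiveAt u' α' x) :
    IsPrimitiveAt (u - u') (α - α') x := by
  refine ⟨h.1.sub h'.1, fun v => ?_⟩
  have := mfderiv_sub h.1 h'.1
  have h2 := congrArg (fun L : E →L[ℝ] ℝ => L v) this
  exact h2.trans (congrArg₂ (fun a b : ℝ => a - b) (h.2 v) (h'.2 v))

theorem congr_form (h : IsPrimitiveAt u α x) (h' : α' x = α x) : IsPrimitiveAt u α' x :=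
  ⟨h.1, fun v => by rw [h', h.2]⟩

/-- In the chart around `x` the function has zero derivative on a ball, and a ball is convex. All
local constancy of cocycles rests on this. -/
theorem eventually_eq [J.Boundaryless] [IsManifold J ∞ M]
    (h : ∀ᶠ y in 𝓝 x, IsPrimitiveAt u (0 : DiffForm J M 1) y) : ∀ᶠ y in 𝓝 x, u y = u x := by
  have hx := mem_extChartAt_source (I := J) x
  have hs : ∀ᶠ z in 𝓝 (extChartAt J x x), z ∈ (extChartAt J x).target ∧
      IsPrimitiveAt u (0 : DiffForm J M 1) ((extChartAt J x).symm z) := by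
    refine Filter.Eventually.and ((isOpen_extChartAt_target x).mem_nhds
      ((extChartAt J x).map_source hx)) ?_
    refine (DiffForm.contMDiffAt_extChartAt_symm x
      ((extChartAt J x).map_source hx)).continuousAt.eventually ?_
    rwa [(extChartAt J x).left_inv hx]
  obtain ⟨r, hr, hball⟩ := Metric.eventually_nhds_iff_ball.1 hs
  have hd : ∀ z ∈ Metric.ball (extChartAt J x x) r,
      HasFDerivAt (u ∘ (extChartAt J x).symm) (0 : E →L[ℝ] ℝ) z := by
    intro z hz
    obtain ⟨h1, h2⟩ := hball z hz
    have h3 := (DiffForm.contMDiffAt_extChartAt_symm (J := J) x h1).mdifferentiableAt (by simp)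
    have h4 : (mfderiv J 𝓘(ℝ, ℝ) u ((extChartAt J x).symm z) : E →L[ℝ] ℝ) = 0 :=
      ContinuousLinearMap.ext fun v => h2.2 v
    have h5 := h2.1.hasMFDerivAt.comp z h3.hasMFDerivAt
    have h6 := h5.hasFDerivAt
    refine h6.congr_fderiv ?_
    exact (congrArg (fun L : E →L[ℝ] ℝ => L.comp (mfderiv 𝓘(ℝ, E) J (extChartAt J x).symm z :
      E →L[ℝ] E)) h4).trans (ContinuousLinearMap.zero_comp _)
  have hc : ∀ᶠ y in 𝓝 x, extChartAt J x y ∈ Metric.ball (extChartAt J x x) r :=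
    (continuousAt_extChartAt x).eventually (Metric.ball_mem_nhds _ hr)
  filter_upwards [hc, (isOpen_extChartAt_source (I := J) x).mem_nhds hx] with y hy hys
  have := (convex_ball (extChartAt J x x) r).is_const_of_fderivWithin_eq_zero (𝕜 := ℝ)
    (f := u ∘ (extChartAt J x).symm)
    (fun z hz => (hd z hz).differentiableAt.differentiableWithinAt)
    (fun z hz => by
      rw [fderivWithin_eq_fderiv (Metric.isOpen_ball.uniqueDiffWithinAt hz)
        (hd z hz).differentiableAt, (hd z hz).fderiv]) hy (Metric.mem_ball_self hr)
  rwa [Function.comp_apply, Function.comp_apply, (extChartAt J x).left_inv hys,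
    (extChartAt J x).left_inv hx] at this

end IsPrimitiveAt

/-- Every smooth closed `1`-form on `W` has a smooth primitive. -/
def HasPrimitives (J : ModelWithCorners ℝ E H) (W : Opens M) : Prop :=
  ∀ α : DiffForm J M 1, α.SmoothOn W → α.IsExtDerivOn 0 W →
    ∃ u : M → ℝ, ContMDiffOn J 𝓘(ℝ, ℝ) ∞ u W ∧ ∀ y ∈ W, IsPrimitiveAt u α y

section Charts

variable [J.Boundaryless] [IsManifold J ∞ M]

variable (J) in
/-- The preimage in the chart around `x` of the ball of radius `r`. -/
def chartBall (x : M) (r : ℝ) : Opens M :=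
  ⟨(extChartAt J x).source ∩ extChartAt J x ⁻¹' Metric.ball (extChartAt J x x) r,
    (continuousOn_extChartAt x).isOpen_inter_preimage (isOpen_extChartAt_source x)
      Metric.isOpen_ball⟩

omit [J.Boundaryless] [IsManifold J ∞ M] in
theorem mem_chartBall (x : M) {r : ℝ} (hr : 0 < r) : x ∈ chartBall J x r :=
  ⟨mem_extChartAt_source x, Metric.mem_ball_self hr⟩

omit [IsManifold J ∞ M] in
-- For large `r` the chart may cover only part of the Euclidean ball. For small `r` the whole ball
-- lies in the target of the chart, so the Poincaré lemmas apply on it.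
theorem exists_chartBall_subset {x : M} {O : Set M} (hO : O ∈ 𝓝 x) : ∃ r, 0 < r ∧
    Metric.ball (extChartAt J x x) r ⊆ DiffForm.chartDomain J x (chartBall J x r : Set M) ∧
    (chartBall J x r : Set M) ⊆ O := by
  have hx := mem_extChartAt_source (I := J) x
  have h1 : (extChartAt J x).symm ⁻¹' O ∈ 𝓝 (extChartAt J x x) := by
    refine ContinuousAt.preimage_mem_nhds (continuousAt_extChartAt_symm x) ?_
    rwa [(extChartAt J x).left_inv hx]
  obtain ⟨r, hr, hball⟩ := Metric.mem_nhds_iff.1 (Filter.inter_mem ((isOpen_extChartAt_target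
    x).mem_nhds ((extChartAt J x).map_source hx)) h1)
  refine ⟨r, hr, fun y hy => ⟨(hball hy).1, (extChartAt J x).map_target (hball hy).1, ?_⟩, ?_⟩
  · rw [mem_preimage, (extChartAt J x).right_inv (hball hy).1]
    exact hy
  · rintro y ⟨hy, hy'⟩
    have := (hball hy').2
    rwa [mem_preimage, (extChartAt J x).left_inv hy] at this

theorem exists_hasPrimitives {x : M} {O : Set M} (hO : O ∈ 𝓝 x) :
    ∃ W : Opens M, x ∈ W ∧ (W : Set M) ⊆ O ∧ HasPrimitives J W := by
  obtain ⟨r, hr, hball, hsub⟩ := exists_chartBall_subset (J := J) hO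
  refine ⟨chartBall J x r, mem_chartBall x hr, hsub, fun α hα hd => ?_⟩
  obtain ⟨f, hf, hfd⟩ := exists_contDiffOn_fderiv_eq (convex_ball (extChartAt J x x) r)
    Metric.isOpen_ball ((hα x).mono hball) (fun z hz => hd x z (hball hz))
  have hs : ∀ y ∈ chartBall J x r, ContMDiffAt J 𝓘(ℝ, ℝ) ∞ (f ∘ extChartAt J x) y :=
    fun y hy => (hf.contDiffAt (Metric.isOpen_ball.mem_nhds hy.2)).contMDiffAt.comp y
      (DiffForm.contMDiffAt_extChartAt' x hy.1)
  refine ⟨f ∘ extChartAt J x, fun y hy => (hs y hy).contMDiffWithinAt, fun y hy =>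
    ⟨(hs y hy).mdifferentiableAt (by simp), fun v => ?_⟩⟩
  have h1 : MDifferentiableAt 𝓘(ℝ, E) 𝓘(ℝ, ℝ) f (extChartAt J x y) :=
    (hf.contDiffAt (Metric.isOpen_ball.mem_nhds hy.2)).contMDiffAt.mdifferentiableAt (by simp)
  have h2 := (DiffForm.contMDiffAt_extChartAt' (J := J) x hy.1).mdifferentiableAt (by simp)
  rw [← DiffForm.pullback_extChartAt_inChart α x hy.1, mfderiv_comp y h1 h2, mfderiv_eq_fderiv]
  exact hfd _ hy.2 _

end Charts

end Primitives

/-! ### Local potentials of a closed `2`-form and their differences -/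

section LocalObjects

variable {E : Type v} [NormedAddCommGroup E] [NormedSpace ℝ E] [FiniteDimensional ℝ E]
  {N : Type u} [TopologicalSpace N] [ChartedSpace E N] [IsManifold 𝓘(ℝ, E) ∞ N]
  {Ω : DiffForm 𝓘(ℝ, E) N 2}

theorem exists_rObj (hsm : Ω.SmoothOn Set.univ) (hclosed : Ω.IsExtDerivOn 0 Set.univ) (x : N) :
    ∃ V : Opens N, x ∈ V ∧ Nonempty (RObj Ω V) := by
  obtain ⟨r, hr, hball, -⟩ := exists_chartBall_subset (J := 𝓘(ℝ, E)) (x := x) Filter.univ_mem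
  have hball' : Metric.ball (extChartAt 𝓘(ℝ, E) x x) r ⊆ DiffForm.chartDomain 𝓘(ℝ, E) x Set.univ :=
    hball.trans fun _ hy => ⟨hy.1, trivial⟩
  obtain ⟨β, ε, hε, hεr, hβ, hd⟩ := exists_contDiffOn_extDeriv_eq hr ((hsm x).mono hball')
    (fun z hz => hclosed x z (hball' hz))
  have hs : ∀ y ∈ chartBall 𝓘(ℝ, E) x ε, ContMDiffAt 𝓘(ℝ, E) 𝓘(ℝ, E) ∞ (extChartAt 𝓘(ℝ, E) x) y :=
    fun y hy => DiffForm.contMDiffAt_extChartAt' x hy.1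
  have hs' : ContMDiffOn 𝓘(ℝ, E) 𝓘(ℝ, E) ∞ (extChartAt 𝓘(ℝ, E) x) (chartBall 𝓘(ℝ, E) x ε) :=
    fun y hy => (hs y hy).contMDiffWithinAt
  have hm : MapsTo (extChartAt 𝓘(ℝ, E) x) (chartBall 𝓘(ℝ, E) x ε)
      (Metric.ball (extChartAt 𝓘(ℝ, E) x x) ε) := fun y hy => hy.2
  have hβ' : DiffForm.SmoothOn (J := 𝓘(ℝ, E)) β (Metric.ball (extChartAt 𝓘(ℝ, E) x x) ε) :=
    DiffForm.smoothOn_self_iff.2 hβ.contDiffOn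
  have hd' : DiffForm.IsExtDerivOn (J := 𝓘(ℝ, E)) β (Ω.inChart x)
      (Metric.ball (extChartAt 𝓘(ℝ, E) x x) ε) := DiffForm.isExtDerivOn_self_iff.2 hd
  refine ⟨chartBall 𝓘(ℝ, E) x ε, mem_chartBall x hε,
    ⟨DiffForm.pullback (J' := 𝓘(ℝ, E)) (M' := E) 𝓘(ℝ, E) (extChartAt 𝓘(ℝ, E) x) β, ?_, ?_⟩⟩
  · exact hβ'.pullback (chartBall 𝓘(ℝ, E) x ε).isOpen Metric.isOpen_ball hs' hm
  · exact (hd'.pullback (chartBall 𝓘(ℝ, E) x ε).isOpen Metric.isOpen_ball hs' hm hβ').congr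
      (chartBall 𝓘(ℝ, E) x ε).isOpen (fun _ _ => rfl)
      fun y hy => (DiffForm.pullback_extChartAt_inChart Ω x hy.1).symm

omit [FiniteDimensional ℝ E] [IsManifold 𝓘(ℝ, E) ∞ N] in
theorem DiffForm.neg_smoothOn {k : ℕ} {α : DiffForm 𝓘(ℝ, E) N k} {V : Set N} (hα : α.SmoothOn V) :
    (-α).SmoothOn V := fun x₀ => (hα x₀).neg

omit [FiniteDimensional ℝ E] [IsManifold 𝓘(ℝ, E) ∞ N] in
theorem DiffForm.IsExtDerivOn.neg {k : ℕ} {α : DiffForm 𝓘(ℝ, E) N k}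
    {β : DiffForm 𝓘(ℝ, E) N (k + 1)} {V : Set N} (h : α.IsExtDerivOn β V) :
    (-α).IsExtDerivOn (-β) V := fun x₀ y hy => by
  have h1 : (-α).inChart x₀ = (-1 : ℝ) • α.inChart x₀ :=
    (show (-α).inChart x₀ = -(α.inChart x₀) from rfl).trans (neg_one_smul ℝ _).symm
  have h2 : (-β).inChart x₀ y = (-1 : ℝ) • β.inChart x₀ y :=
    (show (-β).inChart x₀ y = -(β.inChart x₀ y) from rfl).trans (neg_one_smul ℝ _).symm
  rw [h1, h2, extDeriv_smul, h x₀ y hy]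

omit [FiniteDimensional ℝ E] [IsManifold 𝓘(ℝ, E) ∞ N] in
/-- Two objects of `C'(Ω)` over a set with primitives differ by the differential of a function. -/
theorem HasPrimitives.exists_sub {W : Opens N} (hW : HasPrimitives 𝓘(ℝ, E) W) (e e' : RObj Ω W) :
    ∃ u : N → ℝ, ContMDiffOn 𝓘(ℝ, E) 𝓘(ℝ, ℝ) ∞ u W ∧
      ∀ y ∈ W, IsPrimitiveAt u (e.form - e'.form) y := by
  have h := e.ext_deriv.add W.isOpen e.smooth (DiffForm.neg_smoothOn e'.smooth) e'.ext_deriv.neg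
  rw [add_neg_cancel, ← sub_eq_add_neg] at h
  have h2 := e.smooth.add (DiffForm.neg_smoothOn e'.smooth)
  rw [← sub_eq_add_neg] at h2
  exact hW _ h2 h

end LocalObjects

/-! ### Locally classifying cocycles: uniqueness of the class, and existence for `C'(Ω)` -/

section Classifying

/-- A function that is constant near each point of `overlap U s` as a locally constant function. -/
def lcOfEventually {N : Type u} [TopologicalSpace N] {A : Type*} (V : Opens N) (f : N → A)
    (h : ∀ x ∈ V, ∀ᶠ y in 𝓝 x, f y = f x) : LocallyConstant V A :=
  ⟨fun x => f x, (IsLocallyConstant.iff_eventually_eq _).2 fun x =>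
    continuous_subtype_val.continuousAt.eventually (h x x.2)⟩

theorem mem_overlap_iff {N : Type u} [TopologicalSpace N] {I : Type w} {U : I → Opens N} {n : ℕ}
    {s : Fin n → I} {x : N} : x ∈ overlap U s ↔ ∀ a, x ∈ U (s a) := Set.mem_iInter

/-- A `2`-cochain that is pointwise the coboundary of a family of functions is a cocycle. -/
theorem cocycle_of_pointwise {N : Type u} [TopologicalSpace N] {A : Type*} [AddCommGroup A]
    {I : Type w} {U : I → Opens N} {c : CechCochain U A 2} (z : I → I → N → A)
    (h : ∀ (s : Fin 3 → I) (x : overlap U s),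
      z (s 0) (s 1) x + z (s 1) (s 2) x = c s x + z (s 0) (s 2) x) :
    c ∈ CechCocycle U A 2 := by
  have h' : ∀ (s : Fin 3 → I) (x : overlap U s),
      c s x = z (s 0) (s 1) x + z (s 1) (s 2) x - z (s 0) (s 2) x := fun s x => by
    rw [h s x, add_sub_cancel_right]
  rw [AddMonoidHom.mem_ker]
  funext s
  ext x
  rw [cechD_apply]
  -- The `z i j` are arbitrary functions rather than cochains, so `cechD_cechD` does not apply; the
  -- four faces, of three terms each, are cancelled explicitly.
  refine (Fin.sum_univ_four _).trans ?_
  simp only [h', Function.comp_apply]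
  have e1 : (Fin.succAbove (1 : Fin 4) (0 : Fin 3)) = 0 := rfl
  have e2 : (Fin.succAbove (1 : Fin 4) (1 : Fin 3)) = 2 := rfl
  have e3 : (Fin.succAbove (1 : Fin 4) (2 : Fin 3)) = 3 := rfl
  have e4 : (Fin.succAbove (2 : Fin 4) (0 : Fin 3)) = 0 := rfl
  have e5 : (Fin.succAbove (2 : Fin 4) (1 : Fin 3)) = 1 := rfl
  have e6 : (Fin.succAbove (2 : Fin 4) (2 : Fin 3)) = 3 := rfl
  have e7 : (Fin.succAbove (3 : Fin 4) (0 : Fin 3)) = 0 := rfl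
  have e8 : (Fin.succAbove (3 : Fin 4) (1 : Fin 3)) = 1 := rfl
  have e9 : (Fin.succAbove (3 : Fin 4) (2 : Fin 3)) = 2 := rfl
  have f1 : (Fin.succAbove (0 : Fin 4) (0 : Fin 3)) = 1 := rfl
  have f2 : (Fin.succAbove (0 : Fin 4) (1 : Fin 3)) = 2 := rfl
  have f3 : (Fin.succAbove (0 : Fin 4) (2 : Fin 3)) = 3 := rfl
  simp only [e1, e2, e3, e4, e5, e6, e7, e8, e9, f1, f2, f3]
  have g0 : (-1 : ℤ) ^ ((0 : Fin 4) : ℕ) = 1 := rfl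
  have g1 : (-1 : ℤ) ^ ((1 : Fin 4) : ℕ) = -1 := rfl
  have g2 : (-1 : ℤ) ^ ((2 : Fin 4) : ℕ) = 1 := rfl
  have g3 : (-1 : ℤ) ^ ((3 : Fin 4) : ℕ) = -1 := rfl
  change _ = (0 : A)
  rw [g0, g1, g2, g3]
  simp only [one_smul, neg_smul]
  abel

variable {E : Type v} [NormedAddCommGroup E] [NormedSpace ℝ E]
  {N : Type u} [TopologicalSpace N] [ChartedSpace E N]
  {A : Type*} [AddCommGroup A] {φ : ℝ →+ A}

/-- Near `x`, the function `z` is of the form `φ ∘ u` with `du = α`. -/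
def IsPotentialAt (φ : ℝ →+ A) (z : N → A) (α : DiffForm 𝓘(ℝ, E) N 1) (x : N) : Prop :=
  ∃ u : N → ℝ, ∀ᶠ y in 𝓝 x, z y = φ (u y) ∧ IsPrimitiveAt u α y

namespace IsPotentialAt

variable {z z' : N → A} {α α' : DiffForm 𝓘(ℝ, E) N 1} {x : N}

theorem add (h : IsPotentialAt φ z α x) (h' : IsPotentialAt φ z' α' x) :
    IsPotentialAt φ (z + z') (α + α') x := by
  obtain ⟨u, hu⟩ := h
  obtain ⟨u', hu'⟩ := h'
  refine ⟨u + u', ?_⟩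
  filter_upwards [hu, hu'] with y hy hy'
  exact ⟨by simp [hy.1, hy'.1], hy.2.add hy'.2⟩

theorem sub (h : IsPotentialAt φ z α x) (h' : IsPotentialAt φ z' α' x) :
    IsPotentialAt φ (z - z') (α - α') x := by
  obtain ⟨u, hu⟩ := h
  obtain ⟨u', hu'⟩ := h'
  refine ⟨u - u', ?_⟩
  filter_upwards [hu, hu'] with y hy hy'
  exact ⟨by simp [hy.1, hy'.1], hy.2.sub hy'.2⟩

theorem of_primitive {u : N → ℝ} {W : Opens N} (h : ∀ y ∈ W, IsPrimitiveAt u α y) (hx : x ∈ W) :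
    IsPotentialAt φ (φ ∘ u) α x := by
  refine ⟨u, ?_⟩
  filter_upwards [W.isOpen.mem_nhds hx] with y hy
  exact ⟨rfl, h y hy⟩

theorem eventually_eq [IsManifold 𝓘(ℝ, E) ∞ N]
    (h : IsPotentialAt φ z (0 : DiffForm 𝓘(ℝ, E) N 1) x) : ∀ᶠ y in 𝓝 x, z y = z x := by
  obtain ⟨u, hu⟩ := h
  filter_upwards [hu, IsPrimitiveAt.eventually_eq (hu.mono fun _ h => h.2)] with y hy hy'
  rw [hy.1, hu.self_of_nhds.1, hy']

end IsPotentialAt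

/-- `c` is, for local potentials `e i` of `Ω` over `U i`, the coboundary of functions `z i j` that
are locally of the form `φ ∘ u` with `du = e j - e i`. For `φ = id` and `φ = exp (2 π i ·)` this is
a common weakening of the two notions of classifying cocycle. -/
def IsLocallyClassifying (φ : ℝ →+ A) (Ω : DiffForm 𝓘(ℝ, E) N 2) {I : Type w} (U : I → Opens N)
    (c : CechCochain U A 2) : Prop :=
  ∃ (e : ∀ i, RObj Ω (U i)) (z : I → I → N → A),
    (∀ i j x, x ∈ U i → x ∈ U j → IsPotentialAt φ (z i j) ((e j).form - (e i).form) x) ∧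
    ∀ (s : Fin 3 → I) (x : overlap U s),
      z (s 0) (s 1) x + z (s 1) (s 2) x = c s x + z (s 0) (s 2) x

/-- Restriction of an object of `C'(Ω)`. -/
def RObj.restrict {Ω : DiffForm 𝓘(ℝ, E) N 2} {U V : Opens N} (e : RObj Ω U) (h : V ≤ U) :
    RObj Ω V := ⟨e.form, e.smooth.mono h, e.ext_deriv.mono h⟩

theorem IsLocallyClassifying.refine {Ω : DiffForm 𝓘(ℝ, E) N 2} {I : Type*} {K : Type*}
    {U : I → Opens N} {V : K → Opens N} {c : CechCochain U A 2} (hc : IsLocallyClassifying φ Ω U c)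
    (τ : K → I) (h : ∀ k, V k ≤ U (τ k)) :
    IsLocallyClassifying φ Ω V (cechRefine τ h A 2 c) := by
  obtain ⟨e, z, hz, hc⟩ := hc
  exact ⟨fun k => (e (τ k)).restrict (h k), fun i j => z (τ i) (τ j),
    fun i j x hi hj => hz _ _ x (h i hi) (h j hj),
    fun s x => hc (τ ∘ s) ⟨x, overlap_mono τ h s x.2⟩⟩

/-- With `d(f i) = e i - e' i`, the function `z i j - z' i j + φ (f i) - φ (f j)` has a local
logarithm through `φ` with differential `(e j - e i) - (e' j - e' i) + (e i - e' i) - (e j - e' j) =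
0`. It is therefore a cochain, and in its coboundary the `f` terms telescope away. -/
theorem IsLocallyClassifying.sub_mem_boundary [IsManifold 𝓘(ℝ, E) ∞ N]
    {Ω : DiffForm 𝓘(ℝ, E) N 2} {I : Type*} {U : I → Opens N} {c c' : CechCochain U A 2}
    (hU : ∀ i, HasPrimitives 𝓘(ℝ, E) (U i)) (hc : IsLocallyClassifying φ Ω U c)
    (hc' : IsLocallyClassifying φ Ω U c') : c - c' ∈ cechBoundary U A 2 := by
  obtain ⟨e, z, hz, hc⟩ := hc
  obtain ⟨e', z', hz', hc'⟩ := hc'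
  choose f _ hf using fun i => (hU i).exists_sub (e i) (e' i)
  have hb : ∀ i j x, x ∈ U i → x ∈ U j → ∀ᶠ y in 𝓝 x,
      (z i j - z' i j + (φ ∘ f i - φ ∘ f j)) y = (z i j - z' i j + (φ ∘ f i - φ ∘ f j)) x := by
    intro i j x hi hj
    have h := ((hz i j x hi hj).sub (hz' i j x hi hj)).add
      ((IsPotentialAt.of_primitive (φ := φ) (hf i) hi).sub (IsPotentialAt.of_primitive (hf j) hj))
    apply IsPotentialAt.eventually_eq (E := E)
    convert h using 1
    abel
  refine ⟨fun s => lcOfEventually (overlap U s) _ fun x hx =>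
    hb (s 0) (s 1) x (overlap_le U s 0 hx) (overlap_le U s 1 hx), ?_⟩
  funext s
  ext x
  rw [cechD_apply]
  have h1 := eq_sub_of_add_eq (hc s x).symm
  have h2 := eq_sub_of_add_eq (hc' s x).symm
  change _ = c s x - c' s x
  rw [h1, h2]
  have g0 : (-1 : ℤ) ^ ((0 : Fin 3) : ℕ) = 1 := rfl
  have g1 : (-1 : ℤ) ^ ((1 : Fin 3) : ℕ) = -1 := rfl
  have g2 : (-1 : ℤ) ^ ((2 : Fin 3) : ℕ) = 1 := rfl
  have hv : ∀ (i j : I), (z i j - z' i j + (φ ∘ f i - φ ∘ f j)) x =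
    z i j x - z' i j x + (φ (f i x) - φ (f j x)) := fun _ _ => rfl
  rw [Fin.sum_univ_three, g0, g1, g2]
  simp only [one_smul, neg_smul]
  change (z (s 1) (s 2) - z' (s 1) (s 2) + (φ ∘ f (s 1) - φ ∘ f (s 2))) x +
    -(z (s 0) (s 2) - z' (s 0) (s 2) + (φ ∘ f (s 0) - φ ∘ f (s 2))) x +
    (z (s 0) (s 1) - z' (s 0) (s 1) + (φ ∘ f (s 0) - φ ∘ f (s 1))) x = _
  rw [hv, hv, hv]
  abel

/-- The class of a locally classifying cocycle only depends on `Ω`. -/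
theorem IsLocallyClassifying.ptClass_eq [IsManifold 𝓘(ℝ, E) ∞ N] {Ω : DiffForm 𝓘(ℝ, E) N 2}
    {W W' : PtCover N} {c : CechCocycle W.1 A 2} {c' : CechCocycle W'.1 A 2}
    (hc : IsLocallyClassifying φ Ω W.1 c.1) (hc' : IsLocallyClassifying φ Ω W'.1 c'.1) :
    ptClass W 2 c = ptClass W' 2 c' := by
  -- A common refinement made of sets on which closed `1`-forms are exact.
  choose V hxV hV hp using fun x => exists_hasPrimitives (J := 𝓘(ℝ, E))
    (((W.1 x ⊓ W'.1 x).isOpen.mem_nhds ⟨W.2 x, W'.2 x⟩))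
  let V' : PtCover N := ⟨V, hxV⟩
  have h : W ≤ V' := fun x y hy => (hV x hy).1
  have h' : W' ≤ V' := fun x y hy => (hV x hy).2
  rw [← ptClass_refine h, ← ptClass_refine h', ← sub_eq_zero, ← map_sub]
  exact ptClass_eq_zero_of_mem (IsLocallyClassifying.sub_mem_boundary hp (hc.refine id h)
    (hc'.refine id h'))

/-! ### Classifying cocycles of `C'(Ω)` -/

theorem IsRClassifying.isLocallyClassifying {Ω : DiffForm 𝓘(ℝ, E) N 2} {I : Type w}
    {U : I → Opens N} {c : CechCochain U ℝ 2} (h : IsRClassifying Ω U c) :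
    IsLocallyClassifying (AddMonoidHom.id ℝ) Ω U c := by
  obtain ⟨e, g, h⟩ := h
  refine ⟨e, fun i j => (g i j).toFun, fun i j x hi hj => ⟨(g i j).toFun, ?_⟩, h⟩
  filter_upwards [(U i ⊓ U j).isOpen.mem_nhds ⟨hi, hj⟩] with y hy
  exact ⟨rfl, ((g i j).smooth.contMDiffAt ((U i ⊓ U j).isOpen.mem_nhds hy)).mdifferentiableAt
    (by simp), fun v => (g i j).deriv_eq y hy v⟩

theorem IsRClassifying.mem_cocycle {Ω : DiffForm 𝓘(ℝ, E) N 2} {I : Type w}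
    {U : I → Opens N} {c : CechCochain U ℝ 2} (h : IsRClassifying Ω U c) :
    c ∈ CechCocycle U ℝ 2 := by
  obtain ⟨e, g, h⟩ := h
  exact cocycle_of_pointwise (fun i j => (g i j).toFun) h

/-- In a paracompact Hausdorff space every open cover has a pointwise star refinement. -/
theorem exists_star_refinement {N : Type*} [TopologicalSpace N] [T2Space N] [ParacompactSpace N]
    (U : N → Opens N) (hU : ∀ x, x ∈ U x) : ∃ V : N → Set N, (∀ x, V x ∈ 𝓝 x) ∧
      ∀ x y, (V x ∩ V y).Nonempty → ∃ k, V x ⊆ U k ∧ V y ⊆ U k := by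
  obtain ⟨O, hO, hOc, hOf, hOU⟩ := precise_refinement (fun x => (U x : Set N))
    (fun x => (U x).isOpen) (Set.eq_univ_of_forall fun x => Set.mem_iUnion.2 ⟨x, hU x⟩)
  obtain ⟨C, hCc, hCcl, hCO⟩ := exists_iUnion_eq_closed_subset hO (fun x => hOf.point_finite x) hOc
  have hCf : LocallyFinite C := hOf.subset hCO
  -- The neighbourhood of `x` is the intersection of the `O i` with `x ∈ C i`, minus every `C i`
  -- that misses `x`. If it contains a point of `C k` then `x ∈ C k`, so it lies in `O k`; one `k`
  -- thus serves for two neighbourhoods that meet.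
  refine ⟨fun x => (⋂ i ∈ {i | x ∈ C i}, O i) ∩ ⋂ (i) (_ : x ∉ C i), (C i)ᶜ, fun x => ?_, ?_⟩
  · refine Filter.inter_mem ?_ (hCf.iInter_compl_mem_nhds hCcl x)
    exact (Filter.biInter_mem (hCf.point_finite x)).2 fun i hi => (hO i).mem_nhds (hCO i hi)
  · rintro x y ⟨p, hpx, hpy⟩
    obtain ⟨k, hk⟩ := Set.mem_iUnion.1 (hCc.symm ▸ Set.mem_univ p : p ∈ ⋃ i, C i)
    have key : ∀ x, (p ∈ (⋂ i ∈ {i | x ∈ C i}, O i) ∩ ⋂ (i) (_ : x ∉ C i), (C i)ᶜ) → x ∈ C k := by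
      intro x hp
      by_contra h
      exact Set.mem_iInter₂.1 hp.2 k h hk
    have key2 : ∀ x, x ∈ C k → ((⋂ i ∈ {i | x ∈ C i}, O i) ∩ ⋂ (i) (_ : x ∉ C i), (C i)ᶜ) ⊆ U k :=
      fun x hx q hq => hOU k (Set.mem_iInter₂.1 hq.1 k hx)
    exact ⟨k, key2 x (key x hpx), key2 y (key y hpy)⟩

/-- Nothing is known about the topology of `U x ∩ U y`, so `e y - e x` cannot be integrated there
directly. Both sets lie in a common `Y k` with a potential `f`; `e x - f` and `e y - f` have
primitives on all of `U x` and `U y`, and the difference of these is the morphism. -/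
theorem exists_isRClassifying [FiniteDimensional ℝ E] [IsManifold 𝓘(ℝ, E) ∞ N] [T2Space N]
    [ParacompactSpace N] {Ω : DiffForm 𝓘(ℝ, E) N 2} (hsm : Ω.SmoothOn Set.univ)
    (hclosed : Ω.IsExtDerivOn 0 Set.univ) :
    ∃ (U : N → Opens N) (c : CechCochain U ℝ 2), (∀ x, ∃ i, x ∈ U i) ∧ IsRClassifying Ω U c := by
  choose Y hxY hY using exists_rObj hsm hclosed
  obtain ⟨V, hV, hVs⟩ := exists_star_refinement Y hxY
  choose U hxU hUV hp using fun x => exists_hasPrimitives (J := 𝓘(ℝ, E)) (hV x)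
  have hk : ∀ x, ∃ k, U x ≤ Y k := fun x => by
    obtain ⟨k, hk, -⟩ := hVs x x ⟨x, hUV x (hxU x), hUV x (hxU x)⟩
    exact ⟨k, (hUV x).trans hk⟩
  choose τ hτ using hk
  let e : ∀ x, RObj Ω (U x) := fun x => (hY (τ x)).some.restrict (hτ x)
  have hg : ∀ x y, Nonempty (RHom (e y) (e x) (U x ⊓ U y)) := by
    intro x y
    by_cases hne : ((U x ⊓ U y : Opens N) : Set N).Nonempty
    · obtain ⟨k, hkx, hky⟩ := hVs x y (hne.mono fun p hp => ⟨hUV x hp.1, hUV y hp.2⟩)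
      let f := (hY k).some
      obtain ⟨ux, hux, hux'⟩ := (hp x).exists_sub (e x) (f.restrict ((hUV x).trans hkx))
      obtain ⟨uy, huy, huy'⟩ := (hp y).exists_sub (e y) (f.restrict ((hUV y).trans hky))
      refine ⟨⟨uy - ux, (huy.mono fun _ h => h.2).sub (hux.mono fun _ h => h.1), fun p hp v => ?_⟩⟩
      have h := ((huy' p hp.2).sub (hux' p hp.1)).2 v
      refine h.trans ?_
      change ((e y).form p _ - f.form p _) - ((e x).form p _ - f.form p _) = _
      ring
    -- Over an empty intersection any function is a morphism.
    · have hne' : ∀ p, p ∉ U x ⊓ U y := fun p hp => hne ⟨p, hp⟩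
      exact ⟨⟨0, contMDiffOn_const, fun p hp => (hne' p hp).elim⟩⟩
  let g : ∀ x y, RHom (e y) (e x) (U x ⊓ U y) := fun x y => (hg x y).some
  have hprim : ∀ x y p, p ∈ U x → p ∈ U y → ∀ᶠ q in 𝓝 p,
      IsPrimitiveAt (g x y).toFun ((e y).form - (e x).form) q := by
    intro x y p hx hy
    filter_upwards [(U x ⊓ U y).isOpen.mem_nhds ⟨hx, hy⟩] with q hq
    exact ⟨((g x y).smooth.contMDiffAt ((U x ⊓ U y).isOpen.mem_nhds hq)).mdifferentiableAt
      (by simp), fun v => (g x y).deriv_eq q hq v⟩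
  have hc : ∀ (s : Fin 3 → N), ∀ p ∈ overlap U s, ∀ᶠ q in 𝓝 p,
      ((g (s 0) (s 1)).toFun + (g (s 1) (s 2)).toFun - (g (s 0) (s 2)).toFun) q =
      ((g (s 0) (s 1)).toFun + (g (s 1) (s 2)).toFun - (g (s 0) (s 2)).toFun) p := by
    intro s p hp
    have h := mem_overlap_iff.1 hp
    refine IsPrimitiveAt.eventually_eq (J := 𝓘(ℝ, E)) ?_
    filter_upwards [hprim _ _ p (h 0) (h 1), hprim _ _ p (h 1) (h 2), hprim _ _ p (h 0) (h 2)]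
      with q h1 h2 h3
    convert (h1.add h2).sub h3 using 1
    abel
  refine ⟨U, fun s => lcOfEventually _ _ (hc s), fun x => ⟨x, hxU x⟩, e, g, fun s x => ?_⟩
  change _ = ((g (s 0) (s 1)).toFun x + (g (s 1) (s 2)).toFun x - (g (s 0) (s 2)).toFun x) + _
  ring

end Classifying

/-! ### The angular form on the circle -/

section AngularForm

open DiffForm

variable {E : Type*} [NormedAddCommGroup E] [NormedSpace ℝ E] {H : Type*} [TopologicalSpace H]
  {J : ModelWithCorners ℝ E H} {M : Type*} [TopologicalSpace M] [ChartedSpace H M]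

theorem DiffForm.ext_fin_one {α β : DiffForm J M 1} {x : M}
    (h : ∀ v : TangentSpace J x, α x (fun _ => v) = β x (fun _ => v)) : α x = β x := by
  refine ContinuousAlternatingMap.ext fun v => ?_
  have : v = fun _ => v 0 := by
    funext i
    rw [Subsingleton.elim i 0]
  rw [this]
  exact h (v 0)

variable (J) in
/-- The derivative in the direction `v` of a function with values in a normed space. -/
def dirDeriv {F : Type*} [NormedAddCommGroup F] [NormedSpace ℝ F] (f : M → F) (x : M)
    (v : TangentSpace J x) : F := mfderiv J 𝓘(ℝ, F) f x v

/-- The `1`-form `Im (conj z dz) / 2 π` on `ℂ`. -/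
def angularForm : DiffForm 𝓘(ℝ, ℂ) ℂ 1 := fun z =>
  (ContinuousAlternatingMap.ofSubsingleton ℝ ℂ ℝ (0 : Fin 1)
    ((2 * Real.pi)⁻¹ • Complex.imCLM.comp (ContinuousLinearMap.mul ℝ ℂ (starRingEnd ℂ z))) :
      ℂ [⋀^Fin 1]→L[ℝ] ℝ)

theorem angularForm_smoothOn : angularForm.SmoothOn Set.univ := by
  refine DiffForm.smoothOn_self_iff.2 (ContDiff.contDiffOn ?_)
  have h1 : ContDiff ℝ ∞ fun z : ℂ => (2 * Real.pi)⁻¹ •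
      Complex.imCLM.comp (ContinuousLinearMap.mul ℝ ℂ (starRingEnd ℂ z)) :=
    (contDiff_const (c := (2 * Real.pi)⁻¹)).smul ((contDiff_const (c := Complex.imCLM)).clm_comp
      ((ContinuousLinearMap.mul ℝ ℂ).contDiff.comp Complex.conjCLE.contDiff))
  let Φ : (ℂ →L[ℝ] ℝ) ≃ₗᵢ[ℝ] (ℂ [⋀^Fin 1]→L[ℝ] ℝ) :=
    ContinuousAlternatingMap.ofSubsingletonLIE (0 : Fin 1)
  exact Φ.contDiff.comp h1

theorem pullback_angularForm_apply (h : M → ℂ) (x : M) (v : TangentSpace J x) :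
    pullback J h angularForm x (fun _ => v) =
      (2 * Real.pi)⁻¹ * (starRingEnd ℂ (h x) * dirDeriv J h x v).im := rfl

theorem pullback_const {E' : Type*} [NormedAddCommGroup E'] [NormedSpace ℝ E'] {H' : Type*}
    [TopologicalSpace H'] {J' : ModelWithCorners ℝ E' H'} {M' : Type*} [TopologicalSpace M']
    [ChartedSpace H' M'] (η : DiffForm J' M' 1) (p : M') (x : M) :
    pullback J (fun _ => p) η x = 0 := by
  apply DiffForm.ext_fin_one (β := 0)
  intro v
  rw [pullback_apply, mfderiv_const]
  exact (η p).map_coord_zero 0 rfl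

/-- For `|a| = |b| = 1`, `conj (ab) d(ab) = conj a da + conj b db`. Working with values in `ℂ`
avoids the charts of the circle. -/
theorem pullback_angularForm_mul {a b : M → ℂ} {x : M} (ha : MDifferentiableAt J 𝓘(ℝ, ℂ) a x)
    (hb : MDifferentiableAt J 𝓘(ℝ, ℂ) b x) (ha' : ‖a x‖ = 1) (hb' : ‖b x‖ = 1) :
    pullback J (fun y => a y * b y) angularForm x =
      pullback J a angularForm x + pullback J b angularForm x := by
  apply DiffForm.ext_fin_one (β := pullback J a angularForm + pullback J b angularForm)
  intro v
  have h := (ha.hasMFDerivAt.mul hb.hasMFDerivAt).mfderiv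
  have h2 : dirDeriv J (fun y => a y * b y) x v =
      a x * dirDeriv J b x v + b x * dirDeriv J a x v :=
    congrArg (fun L : E →L[ℝ] ℂ => L v) h
  change _ = pullback J a angularForm x (fun _ => v) + pullback J b angularForm x (fun _ => v)
  rw [pullback_angularForm_apply, pullback_angularForm_apply, pullback_angularForm_apply, h2,
    ← mul_add]
  congr 1
  rw [← Complex.add_im]
  congr 1
  have h3 : starRingEnd ℂ (a x) * a x = 1 := by
    rw [mul_comm, Complex.mul_conj, Complex.normSq_eq_norm_sq, ha']; simp
  have h4 : starRingEnd ℂ (b x) * b x = 1 := by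
    rw [mul_comm, Complex.mul_conj, Complex.normSq_eq_norm_sq, hb']; simp
  rw [map_mul]
  linear_combination (starRingEnd ℂ (b x) * dirDeriv J b x v) * h3 +
    (starRingEnd ℂ (a x) * dirDeriv J a x v) * h4

theorem hasDerivAt_circleExp (t : ℝ) : HasDerivAt (fun t : ℝ => (Circle.exp (2 * Real.pi * t) : ℂ))
    (2 * Real.pi * Complex.I * (Circle.exp (2 * Real.pi * t) : ℂ)) t := by
  simp only [Circle.coe_exp]
  have h1 : HasDerivAt (fun t : ℝ => ((2 * Real.pi * t : ℝ) : ℂ) * Complex.I)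
      (2 * Real.pi * Complex.I) t := by
    have := (((hasDerivAt_id t).const_mul (2 * Real.pi)).ofReal_comp).mul_const Complex.I
    simpa using this
  simpa [mul_comm] using h1.cexp

theorem pullback_angularForm_exp {u : M → ℝ} {x : M} (hu : MDifferentiableAt J 𝓘(ℝ, ℝ) u x)
    (v : TangentSpace J x) :
    pullback J (fun y => (Circle.exp (2 * Real.pi * u y) : ℂ)) angularForm x (fun _ => v) =
      dirDeriv J u x v := by
  have h1 := (hasDerivAt_circleExp (u x)).hasFDerivAt.hasMFDerivAt.comp x hu.hasMFDerivAt
  have h2 : dirDeriv J (fun y => (Circle.exp (2 * Real.pi * u y) : ℂ)) x v =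
      ((dirDeriv J u x v : ℝ) : ℂ) *
        (2 * Real.pi * Complex.I * (Circle.exp (2 * Real.pi * u x) : ℂ)) :=
    (congrArg (fun L : E →L[ℝ] ℂ => L v) h1.mfderiv).trans (Complex.real_smul
      (x := dirDeriv J u x v)
      (z := 2 * Real.pi * Complex.I * (Circle.exp (2 * Real.pi * u x) : ℂ)))
  rw [pullback_angularForm_apply, h2]
  have h3 : starRingEnd ℂ (Circle.exp (2 * Real.pi * u x) : ℂ) *
      (Circle.exp (2 * Real.pi * u x) : ℂ) = 1 := by
    rw [mul_comm, Complex.mul_conj, Circle.normSq_coe]; simp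
  have h4 : starRingEnd ℂ (Circle.exp (2 * Real.pi * u x) : ℂ) *
      (((dirDeriv J u x v : ℝ) : ℂ) *
        (2 * Real.pi * Complex.I * (Circle.exp (2 * Real.pi * u x) : ℂ))) =
      ((2 * Real.pi * dirDeriv J u x v : ℝ) : ℂ) * Complex.I := by
    generalize (Circle.exp (2 * Real.pi * u x) : ℂ) = w at h3 ⊢
    push_cast
    linear_combination (((dirDeriv J u x v : ℝ) : ℂ) * (2 * Real.pi * Complex.I)) * h3
  rw [h4, Complex.mul_I_im, Complex.ofReal_re]
  field_simp

attribute [local instance] finrank_real_complex_fact'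

theorem contMDiff_circle_coe : ContMDiff (𝓡 1) 𝓘(ℝ, ℂ) ∞ (fun z : Circle => (z : ℂ)) :=
  contMDiff_coe_sphere

/-- The invariant `1`-form on the circle. -/
def circleForm : DiffForm (𝓡 1) Circle 1 := pullback (𝓡 1) (fun z : Circle => (z : ℂ)) angularForm

theorem circleForm_smoothOn : circleForm.SmoothOn Set.univ :=
  angularForm_smoothOn.pullback isOpen_univ isOpen_univ contMDiff_circle_coe.contMDiffOn
    (mapsTo_univ _ _)

/-- There are no nonzero `2`-forms in dimension one. Closedness must be obtained on the circle,
since `angularForm` is not closed on `ℂ`. -/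
theorem circleForm_isExtDerivOn : circleForm.IsExtDerivOn 0 Set.univ := by
  intro x₀ y _
  have : ∀ a : EuclideanSpace ℝ (Fin 1) [⋀^Fin 2]→L[ℝ] ℝ, a = 0 := by
    intro a
    ext v
    refine a.toAlternatingMap.map_linearDependent v fun h => ?_
    have := h.fintype_card_le_finrank
    simp at this
  rw [this (extDeriv _ y)]
  exact (this _).symm

end AngularForm

/-! ### Trivial circle bundles, and the passage from `C'(Ω)` to `C(Ω)` -/

section TrivialBundle

open DiffForm

variable {E : Type v} [NormedAddCommGroup E] [NormedSpace ℝ E]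
  {N : Type u} [TopologicalSpace N] [ChartedSpace E N]
  {Ω : DiffForm 𝓘(ℝ, E) N 2} {U V : Opens N}

/-- The action of the circle on the trivial circle bundle over `U`. -/
abbrev trivialAction (U : Opens N) : MulAction Circle (U × Circle) where
  smul z p := (p.1, z * p.2)
  one_smul _ := Prod.ext rfl (one_mul _)
  mul_smul _ _ _ := Prod.ext rfl (mul_assoc _ _ _)

/-- The connection form `α + dθ / 2 π` on the trivial circle bundle over `U`. -/
def trivialConn (α : DiffForm 𝓘(ℝ, E) N 1) (U : Opens N) :
    DiffForm (totalModel E) (U × Circle) 1 :=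
  pullback (totalModel E) (fun p : U × Circle => (p.1 : N)) α +
    pullback (totalModel E) (fun p : U × Circle => (p.2 : ℂ)) angularForm

theorem contMDiff_exp_two_pi :
    ContMDiff 𝓘(ℝ, ℝ) (𝓡 1) ∞ (fun t : ℝ => Circle.exp (2 * Real.pi * t)) :=
  (contMDiff_circleExp (m := ∞)).comp (contDiff_const.mul contDiff_id).contMDiff

theorem contMDiff_fst_val : ContMDiff (totalModel E) 𝓘(ℝ, E) ∞
    (fun p : U × Circle => (p.1 : N)) := contMDiff_subtype_val.comp contMDiff_fst

theorem contMDiff_snd_coe : ContMDiff (totalModel E) 𝓘(ℝ, ℂ) ∞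
    (fun p : U × Circle => (p.2 : ℂ)) := contMDiff_circle_coe.comp contMDiff_snd

/-- The connection form is written with `ℂ`-valued maps, while closedness is known for the form on
the circle; this identifies the two pull-backs. -/
theorem pullback_snd_circleForm :
    pullback (totalModel E) (fun p : U × Circle => p.2) circleForm =
      pullback (totalModel E) (fun p : U × Circle => (p.2 : ℂ)) angularForm := by
  funext p
  exact (pullback_comp angularForm (contMDiff_circle_coe.mdifferentiable (by simp) _)
    (mdifferentiableAt_snd)).symm

/-- Pull-back of the connection form of a trivial bundle along a map given in components. -/
theorem pullback_trivialConn {E' : Type*} [NormedAddCommGroup E'] [NormedSpace ℝ E'] {H' : Type*}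
    [TopologicalSpace H'] {J : ModelWithCorners ℝ E' H'} {M : Type*} [TopologicalSpace M]
    [ChartedSpace H' M] (α : DiffForm 𝓘(ℝ, E) N 1) {f : M → U × Circle} {x : M}
    (hf : MDifferentiableAt J (totalModel E) f x) :
    pullback J f (trivialConn α U) x =
      pullback J (fun y => ((f y).1 : N)) α x +
        pullback J (fun y => ((f y).2 : ℂ)) angularForm x := by
  have h1 := pullback_comp α ((contMDiff_fst_val (U := U) (E := E)).mdifferentiable (by simp) (f x)) hf
  have h2 := pullback_comp angularForm
    ((contMDiff_snd_coe (U := U) (E := E)).mdifferentiable (by simp) (f x)) hf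
  exact (congrArg₂ (fun a b : E' [⋀^Fin 1]→L[ℝ] ℝ => a + b) h1 h2).symm

theorem trivialConn_invariant (α : DiffForm 𝓘(ℝ, E) N 1) (z : Circle) :
    pullback (totalModel E) (fun p : U × Circle => (p.1, z * p.2)) (trivialConn α U) =
      trivialConn α U := by
  funext p
  have hd : ContMDiff (totalModel E) (totalModel E) ∞ fun p : U × Circle => (p.1, z * p.2) :=
    contMDiff_fst.prodMk (contMDiff_const.mul contMDiff_snd)
  rw [pullback_trivialConn α (hd.mdifferentiable (by simp) p)]
  have h := pullback_angularForm_mul (J := totalModel E) (x := p) (a := fun _ => (z : ℂ))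
    (b := fun p : U × Circle => (p.2 : ℂ)) mdifferentiableAt_const
    (contMDiff_snd_coe.mdifferentiable (by simp) p) (Circle.norm_coe z) (Circle.norm_coe p.2)
  rw [pullback_const, zero_add] at h
  simp only [Circle.coe_mul]
  rw [h]
  rfl

/-- The gauge transformation formula. With `f` constant and `u = id` it gives the normalization on
vertical vectors; with `f` an inclusion of bundles it shows that morphisms preserve connections. -/
theorem pullback_trivialConn_exp {E' : Type*} [NormedAddCommGroup E'] [NormedSpace ℝ E']
    {H' : Type*} [TopologicalSpace H'] {J : ModelWithCorners ℝ E' H'} {M : Type*}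
    [TopologicalSpace M] [ChartedSpace H' M] (α : DiffForm 𝓘(ℝ, E) N 1) {f : M → U × Circle}
    {u : M → ℝ} {x : M} (hf : MDifferentiableAt J (totalModel E) f x)
    (hu : MDifferentiableAt J 𝓘(ℝ, ℝ) u x) (v : TangentSpace J x) :
    pullback J (fun y => ((f y).1, Circle.exp (2 * Real.pi * u y) * (f y).2)) (trivialConn α U) x
        (fun _ => v) =
      pullback J f (trivialConn α U) x (fun _ => v) + dirDeriv J u x v := by
  have he : MDifferentiableAt J (𝓡 1) (fun y => Circle.exp (2 * Real.pi * u y)) x :=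
    (contMDiff_exp_two_pi.mdifferentiable (by simp) _).comp x hu
  have hs : MDifferentiableAt J (𝓡 1) (fun y => (f y).2) x := hf.snd
  have hm : MDifferentiableAt J (𝓡 1) (fun y => Circle.exp (2 * Real.pi * u y) * (f y).2) x :=
    ((contMDiff_mul (𝓡 1) ∞ (G := Circle)).mdifferentiable (by simp) _).comp x (he.prodMk hs)
  have hc := contMDiff_circle_coe.mdifferentiable (by simp)
  rw [pullback_trivialConn α (hf.fst.prodMk hm), pullback_trivialConn α hf]
  have h := pullback_angularForm_mul (J := J) (x := x)
    (a := fun y => (Circle.exp (2 * Real.pi * u y) : ℂ)) (b := fun y => ((f y).2 : ℂ))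
    ((hc _).comp x he) ((hc _).comp x hs) (Circle.norm_coe _) (Circle.norm_coe _)
  have h' : pullback J (fun y => ((Circle.exp (2 * Real.pi * u y) * (f y).2 : Circle) : ℂ))
      angularForm x (fun _ => v) =
      dirDeriv J u x v + pullback J (fun y => ((f y).2 : ℂ)) angularForm x (fun _ => v) :=
    (congrArg (fun a : E' [⋀^Fin 1]→L[ℝ] ℝ => a (fun _ => v)) h).trans
      (congrArg (fun t : ℝ => t + pullback J (fun y => ((f y).2 : ℂ)) angularForm x (fun _ => v))
        (pullback_angularForm_exp hu v))
  refine (congrArg (fun t : ℝ => pullback J (fun y => ((f y).1 : N)) α x (fun _ => v) + t)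
    (h'.trans (add_comm _ _))).trans ?_
  exact (add_assoc _ _ _).symm

variable [IsManifold 𝓘(ℝ, E) ∞ N]

theorem trivialConn_smoothOn {α : DiffForm 𝓘(ℝ, E) N 1} (h : α.SmoothOn U) :
    (trivialConn α U).SmoothOn univ :=
  (h.pullback isOpen_univ U.isOpen contMDiff_fst_val.contMDiffOn fun p _ => p.1.2).add
    (angularForm_smoothOn.pullback isOpen_univ isOpen_univ contMDiff_snd_coe.contMDiffOn
      (mapsTo_univ _ _))

theorem trivialConn_isExtDerivOn (α : RObj Ω U) : (trivialConn α.form U).IsExtDerivOn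
    (Ω.pullback (totalModel E) (fun p : U × Circle => (p.1 : N))) univ := by
  have h1 := α.ext_deriv.pullback (J := totalModel E) isOpen_univ U.isOpen
    contMDiff_fst_val.contMDiffOn (fun (p : U × Circle) _ => p.1.2) α.smooth
  have h2 := circleForm_isExtDerivOn.pullback (J := totalModel E) isOpen_univ isOpen_univ
    (contMDiff_snd (M := U) (N := Circle)).contMDiffOn (mapsTo_univ _ _) circleForm_smoothOn
  have h3 := h1.add isOpen_univ (α.smooth.pullback isOpen_univ U.isOpen
    contMDiff_fst_val.contMDiffOn fun p _ => p.1.2) (circleForm_smoothOn.pullback isOpen_univ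
    isOpen_univ contMDiff_snd.contMDiffOn (mapsTo_univ _ _)) h2
  rw [pullback_zero, add_zero] at h3
  have h4 : pullback (totalModel E) Prod.snd circleForm =
    pullback (totalModel E) (fun p : U × Circle => (p.2 : ℂ)) angularForm := pullback_snd_circleForm
  rw [h4] at h3
  exact h3

/-- The trivial circle bundle with the connection form `α + dθ / 2 π`. -/
def RObj.circleBundle (α : RObj Ω U) : CircleBundle Ω U where
  P := U × Circle
  action := trivialAction U
  smooth_smul := by
    refine ContMDiff.prodMk (f := fun q : Circle × (U × Circle) => q.2.1) ?_ ?_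
    · exact contMDiff_fst.comp contMDiff_snd
    · exact contMDiff_fst.mul (contMDiff_snd.comp contMDiff_snd)
  proj p := p.1
  smooth_proj := contMDiff_fst_val
  proj_mem p := p.1.2
  proj_smul _ _ := rfl
  locally_trivial x hx := by
    -- A single global trivialization: the inclusion of `U` in `N` times the identity of the circle.
    let t := (U.openPartialHomeomorphSubtypeCoe ⟨⟨x, hx⟩⟩).prod
      (OpenPartialHomeomorph.refl Circle)
    refine ⟨⟨t, U, U.isOpen, ?_, ?_, ?_⟩, hx, ?_, ?_, ?_⟩
    · ext p
      exact ⟨fun _ => p.1.2, fun _ => ⟨trivial, trivial⟩⟩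
    · ext p
      simp [t]
    · intro p _
      rfl
    · exact (contMDiff_fst_val.prodMk contMDiff_snd).contMDiffOn
    · rintro ⟨b, w⟩ hb
      have hb' : b ∈ U := by simpa [t] using hb
      refine ContMDiffAt.contMDiffWithinAt (ContMDiffAt.prodMk ?_ contMDiffAt_snd)
      refine (ContMDiffAt.subtypeVal_comp_iff U _ _).1 ?_
      refine (contMDiffAt_fst (M := N) (N := Circle)).congr_of_eventuallyEq ?_
      filter_upwards [(U.isOpen.preimage continuous_fst).mem_nhds hb'] with q hq
      exact (U.openPartialHomeomorphSubtypeCoe ⟨⟨x, hx⟩⟩).right_inv (by simpa using hq)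
    · intro z p _
      rfl
  conn := trivialConn α.form U
  smooth_conn := trivialConn_smoothOn α.smooth
  conn_invariant z := trivialConn_invariant α.form z
  conn_vertical p := by
    have h := pullback_trivialConn_exp (J := 𝓘(ℝ, ℝ)) α.form (f := fun _ : ℝ => p) (u := id) (x := 0)
      mdifferentiableAt_const mdifferentiableAt_id (1 : ℝ)
    have h1 : dirDeriv 𝓘(ℝ, ℝ) (id : ℝ → ℝ) 0 (1 : ℝ) = 1 :=
      congrArg (fun L : ℝ →L[ℝ] ℝ => L 1) mfderiv_id
    rw [pullback_const, h1] at h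
    have h0 : (p.1, Circle.exp (2 * Real.pi * (0 : ℝ)) * p.2) = p := by simp
    have h2 : (trivialConn α.form U (p.1, Circle.exp (2 * Real.pi * (0 : ℝ)) * p.2) :
      (E × EuclideanSpace ℝ (Fin 1)) [⋀^Fin 1]→L[ℝ] ℝ) = trivialConn α.form U p := by rw [h0]
    have h3 := congrArg (fun a : (E × EuclideanSpace ℝ (Fin 1)) [⋀^Fin 1]→L[ℝ] ℝ =>
      a (fun _ => mfderiv 𝓘(ℝ, ℝ) (totalModel E)
        (fun t : ℝ => (p.1, Circle.exp (2 * Real.pi * t) * p.2)) 0 (1 : ℝ))) h2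
    exact h3.symm.trans (h.trans (zero_add _))
  curvature := trivialConn_isExtDerivOn α

section Morphism

variable {U' : Opens N} {α : RObj Ω U} {α' : RObj Ω U'} {W : Opens (U × Circle)}

omit [IsManifold 𝓘(ℝ, E) ∞ N] in
theorem RHom.contMDiff_comp (g : RHom α α' V) (hW : ∀ p ∈ W, (p.1 : N) ∈ V) :
    ContMDiff (totalModel E) 𝓘(ℝ, ℝ) ∞ (fun p : W => g.toFun p.1.1) := fun p =>
  (g.smooth.contMDiffAt (V.isOpen.mem_nhds (hW p p.2))).comp p
    ((contMDiff_fst_val (U := U)).comp contMDiff_subtype_val p)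

omit [IsManifold 𝓘(ℝ, E) ∞ N] in
theorem contMDiff_inclusion_prod (hV : V ≤ U') (hW : ∀ p ∈ W, (p.1 : N) ∈ V) :
    ContMDiff (totalModel E) (totalModel E) ∞
      (fun p : W => ((⟨p.1.1, hV (hW p p.2)⟩, p.1.2) : U' × Circle)) := by
  refine ContMDiff.prodMk ?_ (contMDiff_snd.comp contMDiff_subtype_val)
  exact (ContMDiff.subtypeVal_comp_iff U' _).1
    ((contMDiff_fst_val (U := U)).comp contMDiff_subtype_val)

omit [IsManifold 𝓘(ℝ, E) ∞ N] in
theorem RHom.contMDiff_circleHom (g : RHom α α' V) (hV : V ≤ U') (hW : ∀ p ∈ W, (p.1 : N) ∈ V) :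
    ContMDiff (totalModel E) (totalModel E) ∞
      (fun p : W => ((⟨p.1.1, hV (hW p p.2)⟩,
        Circle.exp (2 * Real.pi * g.toFun p.1.1) * p.1.2) : U' × Circle)) := by
  have h := contMDiff_inclusion_prod (E := E) hV hW
  exact (contMDiff_fst.comp h).prodMk
    ((contMDiff_exp_two_pi.comp (g.contMDiff_comp hW)).mul (contMDiff_snd.comp contMDiff_subtype_val))

omit [IsManifold 𝓘(ℝ, E) ∞ N] in
-- By the gauge formula the pull-back has base part `α' + du`, which is `α`; the angular part is
-- unchanged. Here `W` stands for the total space over `V`, kept as an open subset of an explicit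
-- product.
theorem RHom.pullback_circleHom (g : RHom α α' V) (hV : V ≤ U') (hW : ∀ p ∈ W, (p.1 : N) ∈ V) :
    pullback (totalModel E) (fun p : W => ((⟨p.1.1, hV (hW p p.2)⟩,
        Circle.exp (2 * Real.pi * g.toFun p.1.1) * p.1.2) : U' × Circle))
      (trivialConn α'.form U') =
    pullback (totalModel E) (Subtype.val : W → U × Circle) (trivialConn α.form U) := by
  funext p
  refine DiffForm.ext_fin_one fun v => ?_
  have hd := (contMDiff_inclusion_prod (E := E) hV hW).mdifferentiable (by simp) p
  refine (pullback_trivialConn_exp α'.form hd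
    ((g.contMDiff_comp hW).mdifferentiable (by simp) p) v).trans ?_
  have h1 := pullback_trivialConn α'.form hd
  have h2 := pullback_trivialConn α.form
    ((contMDiff_subtype_val (U := W) (n := ∞)).mdifferentiable (I := totalModel E) (by simp) p)
  rw [h1, h2]
  have hπ := ((contMDiff_fst_val (U := U) (E := E)).comp
    (contMDiff_subtype_val (U := W))).mdifferentiable (by simp) p
  have hu := (g.smooth.contMDiffAt (V.isOpen.mem_nhds (hW p p.2))).mdifferentiableAt (by simp)
  have h3 : dirDeriv (totalModel E) (fun p : W => g.toFun p.1.1) p v =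
      α.form (p.1.1 : N)
        (fun _ => (mfderiv (totalModel E) 𝓘(ℝ, E) (fun p : W => (p.1.1 : N)) p) v) -
      α'.form (p.1.1 : N)
        (fun _ => (mfderiv (totalModel E) 𝓘(ℝ, E) (fun p : W => (p.1.1 : N)) p) v) :=
    (congrArg (fun L : E × EuclideanSpace ℝ (Fin 1) →L[ℝ] ℝ => L v) (mfderiv_comp p hu hπ)).trans
      (g.deriv_eq _ (hW p p.2) _)
  rw [h3]
  change (α'.form (p.1.1 : N) (fun _ => mfderiv (totalModel E) 𝓘(ℝ, E)
      (fun p : W => (p.1.1 : N)) p v) + pullback (totalModel E) (fun p : W => (p.1.2 : ℂ))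
      angularForm p (fun _ => v)) + _ = α.form (p.1.1 : N) (fun _ => mfderiv (totalModel E) 𝓘(ℝ, E)
      (fun p : W => (p.1.1 : N)) p v) + pullback (totalModel E) (fun p : W => (p.1.2 : ℂ))
      angularForm p (fun _ => v)
  ring

end Morphism

/-- The morphism of trivial circle bundles defined by a morphism of the gerbe `C'(Ω)`. -/
def RHom.circleHom {U' : Opens N} {α : RObj Ω U} {α' : RObj Ω U'} (g : RHom α α' V)
    (hV : V ≤ U') : CircleHom α.circleBundle α'.circleBundle V where
  toFun p := (⟨p.1.1.1, hV p.2⟩, Circle.exp (2 * Real.pi * g.toFun p.1.1.1) * p.1.2)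
  smooth := g.contMDiff_circleHom hV fun _ h => h
  proj_eq _ := rfl
  equivariant := by
    rintro z ⟨⟨x, a⟩, hp⟩ ⟨⟨y, b⟩, hq⟩ h
    obtain ⟨rfl, rfl⟩ := Prod.mk.inj (show (y, b) = (x, z * a) from h)
    exact Prod.ext rfl (mul_left_comm _ _ _)
  conn_eq := g.pullback_circleHom hV fun _ h => h

/-- The morphisms of trivial bundles are multiplications by `exp (2πi u)`, so composing them adds
the functions `u`, and the additive relation for `c` becomes the multiplicative one. -/
theorem IsRClassifying.isCircleClassifying {I : Type w} {U : I → Opens N} {c : CechCochain U ℝ 2}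
    (h : IsRClassifying Ω U c) : IsCircleClassifying Ω U (cechCoeff U expT1 2 c) := by
  obtain ⟨e, g, h⟩ := h
  refine ⟨fun i => (e i).circleBundle, fun i j => (g i j).circleHom inf_le_left, ?_⟩
  rintro s p hp q rfl
  have h1 := h s ⟨p.1.1, hp⟩
  refine Prod.ext rfl ?_
  change Circle.exp (2 * Real.pi * (g (s 0) (s 1)).toFun p.1.1) *
    (Circle.exp (2 * Real.pi * (g (s 1) (s 2)).toFun p.1.1) * p.2) =
    Circle.exp (2 * Real.pi * c s ⟨p.1.1, hp⟩) *
      (Circle.exp (2 * Real.pi * (g (s 0) (s 2)).toFun p.1.1) * p.2)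
  rw [← mul_assoc, ← mul_assoc, ← Circle.exp_add, ← Circle.exp_add, ← mul_add, ← mul_add]
  rw [← h1]

end TrivialBundle

/-! ### Arbitrary circle bundles: local sections, transition functions, independence of choices -/

section CircleBundles

open DiffForm

theorem ContinuousAlternatingMap.fin_one_add {F : Type*} [NormedAddCommGroup F]
    [NormedSpace ℝ F] (a : F [⋀^Fin 1]→L[ℝ] ℝ) (v w : F) :
    a (fun _ => v + w) = a (fun _ => v) + a (fun _ => w) := by
  obtain ⟨L, rfl⟩ := (ContinuousAlternatingMap.ofSubsingleton ℝ F ℝ (0 : Fin 1)).surjective a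
  exact map_add L v w

theorem ContinuousAlternatingMap.fin_one_smul {F : Type*} [NormedAddCommGroup F]
    [NormedSpace ℝ F] (a : F [⋀^Fin 1]→L[ℝ] ℝ) (r : ℝ) (v : F) :
    a (fun _ => r • v) = r * a (fun _ => v) := by
  obtain ⟨L, rfl⟩ := (ContinuousAlternatingMap.ofSubsingleton ℝ F ℝ (0 : Fin 1)).surjective a
  exact map_smul L r v

/-- A smooth function with values in the circle has local logarithms. -/
theorem exists_local_log {E : Type*} [NormedAddCommGroup E] [NormedSpace ℝ E] {H : Type*}
    [TopologicalSpace H] {J : ModelWithCorners ℝ E H} {M : Type*} [TopologicalSpace M]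
    [ChartedSpace H M] {z : M → Circle} {x : M}
    (hz : ∀ᶠ y in 𝓝 x, ContMDiffAt J (𝓡 1) ∞ z y) :
    ∃ u : M → ℝ, ∀ᶠ y in 𝓝 x, ContMDiffAt J 𝓘(ℝ, ℝ) ∞ u y ∧ z y = Circle.exp (2 * Real.pi * u y) := by
  -- Division by `z x` moves the value at `x` to `1`, inside the slit plane where the logarithm is
  -- smooth; the argument of `z x` is added back as a constant.
  let q : M → ℂ := fun y => (z y * (z x)⁻¹ : Circle)
  have hq : ∀ᶠ y in 𝓝 x, ContMDiffAt J 𝓘(ℝ, ℂ) ∞ q y := by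
    filter_upwards [hz] with y hy
    exact contMDiff_circle_coe.contMDiffAt.comp y (hy.mul contMDiffAt_const)
  have hq1 : ∀ᶠ y in 𝓝 x, q y ∈ Complex.slitPlane := by
    refine hq.self_of_nhds.continuousAt.eventually (Complex.isOpen_slitPlane.mem_nhds ?_)
    simp [q]
  refine ⟨fun y => (2 * Real.pi)⁻¹ * ((Complex.log (q y)).im + (z x : ℂ).arg), ?_⟩
  filter_upwards [hq, hq1] with y hy hy'
  constructor
  · have h1 : ContDiffAt ℝ ∞ (fun w : ℂ => (2 * Real.pi)⁻¹ * ((Complex.log w).im + (z x : ℂ).arg))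
        (q y) :=
      contDiffAt_const.mul ((Complex.imCLM.contDiff.contDiffAt.comp _
        ((Complex.contDiffAt_log hy').restrict_scalars ℝ)).add contDiffAt_const)
    exact h1.contMDiffAt.comp y hy
  · rw [mul_inv_cancel_left₀ (by positivity), Complex.log_im, Circle.exp_add, Circle.exp_arg,
      Circle.exp_arg]
    simp

variable {E : Type v} [NormedAddCommGroup E] [NormedSpace ℝ E]
  {N : Type u} [TopologicalSpace N] [ChartedSpace E N]
  {Ω : DiffForm 𝓘(ℝ, E) N 2} {U V : Opens N}

namespace CircleBundle

variable (e : CircleBundle Ω U)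

theorem contMDiff_exp_smul : ContMDiff (𝓘(ℝ, ℝ).prod (totalModel E)) (totalModel E) ∞
    (fun q : ℝ × e.P => Circle.exp (2 * Real.pi * q.1) • q.2) :=
  e.smooth_smul.comp ((contMDiff_exp_two_pi.comp contMDiff_fst).prodMk contMDiff_snd)

/-- The time is a variable equal to `0` so that the result can be applied at `t - t`. -/
theorem pullback_vertical (p : e.P) {t : ℝ} (ht : t = 0) (a : ℝ) :
    e.conn.pullback 𝓘(ℝ, ℝ) (fun t : ℝ => Circle.exp (2 * Real.pi * t) • p) t (fun _ => a) = a := by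
  subst ht
  have h0 : Circle.exp (2 * Real.pi * (0 : ℝ)) • p = p := by simp
  have h2 : (e.conn (Circle.exp (2 * Real.pi * (0 : ℝ)) • p) :
    (E × EuclideanSpace ℝ (Fin 1)) [⋀^Fin 1]→L[ℝ] ℝ) = e.conn p := by rw [h0]
  have h3 := congrArg (fun a : (E × EuclideanSpace ℝ (Fin 1)) [⋀^Fin 1]→L[ℝ] ℝ =>
    a (fun _ => mfderiv 𝓘(ℝ, ℝ) (totalModel E)
      (fun t : ℝ => Circle.exp (2 * Real.pi * t) • p) 0 (1 : ℝ))) h2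
  have h4 := h3.trans (e.conn_vertical p)
  have h5 := ContinuousAlternatingMap.fin_one_smul (F := ℝ) (e.conn.pullback 𝓘(ℝ, ℝ)
    (fun t : ℝ => Circle.exp (2 * Real.pi * t) • p) (0 : ℝ)) a 1
  rw [smul_eq_mul, mul_one] at h5
  exact h5.trans ((congrArg (a * ·) h4).trans (mul_one a))

/-- The orbit of `p` near time `t` is the orbit of `exp (2πi t) • p` near time `0`, shifted by `t`.
-/
theorem pullback_orbit (p : e.P) (t a : ℝ) :
    e.conn.pullback 𝓘(ℝ, ℝ) (fun t : ℝ => Circle.exp (2 * Real.pi * t) • p) t (fun _ => a) = a := by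
  have h : (fun t : ℝ => Circle.exp (2 * Real.pi * t) • p) =
      (fun s : ℝ => Circle.exp (2 * Real.pi * s) • Circle.exp (2 * Real.pi * t) • p) ∘
        fun s => s - t := by
    funext s
    simp only [Function.comp_apply, ← mul_smul, ← Circle.exp_add]
    congr 2
    ring
  have hd : MDifferentiableAt 𝓘(ℝ, ℝ) 𝓘(ℝ, ℝ) (fun s : ℝ => s - t) t :=
    ((differentiable_id.sub_const t) t).mdifferentiableAt
  have hc := e.contMDiff_exp_smul.mdifferentiable (by simp)
  have hc' : MDifferentiableAt 𝓘(ℝ, ℝ) (totalModel E)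
      (fun s : ℝ => Circle.exp (2 * Real.pi * s) • Circle.exp (2 * Real.pi * t) • p) (t - t) :=
    (hc (t - t, Circle.exp (2 * Real.pi * t) • p)).comp (t - t)
      (mdifferentiableAt_id.prodMk mdifferentiableAt_const)
  have h1 := pullback_comp (f := fun s : ℝ => s - t) (x := t) e.conn hc' hd
  have h2 : mfderiv 𝓘(ℝ, ℝ) 𝓘(ℝ, ℝ) (fun s : ℝ => s - t) t = ContinuousLinearMap.id ℝ ℝ := by
    rw [mfderiv_eq_fderiv]
    exact (fderiv_sub_const t).trans fderiv_id
  rw [h, h1]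
  refine Eq.trans ?_ (e.pullback_vertical (Circle.exp (2 * Real.pi * t) • p) (sub_self t) a)
  exact congrArg (fun L : ℝ →L[ℝ] ℝ => e.conn.pullback 𝓘(ℝ, ℝ)
    (fun s : ℝ => Circle.exp (2 * Real.pi * s) • Circle.exp (2 * Real.pi * t) • p) (t - t)
    (fun _ => L a)) h2

/-- The connection form along a section that is moved by a function with values in the circle. -/
theorem pullback_exp_smul {E' : Type*} [NormedAddCommGroup E'] [NormedSpace ℝ E'] {H' : Type*}
    [TopologicalSpace H'] {J : ModelWithCorners ℝ E' H'} {M : Type*} [TopologicalSpace M]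
    [ChartedSpace H' M] {f : M → e.P} {u : M → ℝ} {x : M}
    (hf : MDifferentiableAt J (totalModel E) f x) (hu : MDifferentiableAt J 𝓘(ℝ, ℝ) u x)
    (v : TangentSpace J x) :
    e.conn.pullback J (fun y => Circle.exp (2 * Real.pi * u y) • f y) x (fun _ => v) =
      e.conn.pullback J f x (fun _ => v) + dirDeriv J u x v := by
  have hF := e.contMDiff_exp_smul.mdifferentiable (by simp) (u x, f x)
  have h1 := pullback_comp e.conn (f := fun y => (u y, f y)) hF (hu.prodMk hf)
  have h2 := congrArg (fun a : E' [⋀^Fin 1]→L[ℝ] ℝ => a (fun _ => v)) h1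
  refine h2.trans ?_
  let a : ℝ := dirDeriv J u x v
  let w : E × EuclideanSpace ℝ (Fin 1) := mfderiv J (totalModel E) f x v
  have h3 : mfderiv J (𝓘(ℝ, ℝ).prod (totalModel E)) (fun y => (u y, f y)) x v = (a, w) :=
    congrArg (fun L : E' →L[ℝ] ℝ × (E × EuclideanSpace ℝ (Fin 1)) => L v) (hu.mfderiv_prod hf)
  -- The derivative of the action splits into its two partial derivatives. The part `w₁` along the
  -- orbit contributes `du`, and by invariance of the connection `w₂` contributes its value along
  -- `f`.
  let w₁ : E × EuclideanSpace ℝ (Fin 1) := mfderiv 𝓘(ℝ, ℝ) (totalModel E)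
    (fun t : ℝ => Circle.exp (2 * Real.pi * t) • f x) (u x) a
  let w₂ : E × EuclideanSpace ℝ (Fin 1) := mfderiv (totalModel E) (totalModel E)
    (fun p => Circle.exp (2 * Real.pi * u x) • p) (f x) w
  let c : (E × EuclideanSpace ℝ (Fin 1)) [⋀^Fin 1]→L[ℝ] ℝ :=
    e.conn (Circle.exp (2 * Real.pi * u x) • f x)
  have h4 : mfderiv (𝓘(ℝ, ℝ).prod (totalModel E)) (totalModel E)
      (fun q : ℝ × e.P => Circle.exp (2 * Real.pi * q.1) • q.2) (u x, f x) (a, w) = w₁ + w₂ :=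
    mfderiv_prod_eq_add_apply hF
  have h6 : c (fun _ => w₁) = a := e.pullback_orbit (f x) (u x) a
  have h7 : c (fun _ => w₂) = e.conn.pullback J f x (fun _ => v) :=
    congrArg (fun b : (E × EuclideanSpace ℝ (Fin 1)) [⋀^Fin 1]→L[ℝ] ℝ => b (fun _ => w))
      (congrFun (e.conn_invariant (Circle.exp (2 * Real.pi * u x))) (f x))
  have h8 := (congrArg (fun b => c (fun _ => b)) h4).trans (c.fin_one_add w₁ w₂)
  rw [h6, h7] at h8
  refine (Eq.trans ?_ h8).trans (add_comm _ _)
  exact congrArg (fun b => c (fun _ => mfderiv (𝓘(ℝ, ℝ).prod (totalModel E)) (totalModel E)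
      (fun q : ℝ × e.P => Circle.exp (2 * Real.pi * q.1) • q.2) (u x, f x) b)) h3

theorem exists_trivialization {x : N} (hx : x ∈ U) : ∃ t : Bundle.Trivialization Circle e.proj,
    x ∈ t.baseSet ∧ ContMDiffOn (totalModel E) (𝓘(ℝ, E).prod (𝓡 1)) ∞ t t.source ∧
    ContMDiffOn (𝓘(ℝ, E).prod (𝓡 1)) (totalModel E) ∞ t.toOpenPartialHomeomorph.symm t.target ∧
    ∀ (z : Circle), ∀ p, e.proj p ∈ t.baseSet → (t (z • p)).2 = z * (t p).2 := by
  obtain ⟨t, h1, h2, h3, h4⟩ := e.locally_trivial x hx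
  exact ⟨t, h1, h2, h3, fun z p hp => h4 z p (t.mem_source.2 hp)⟩

theorem exists_proj_eq {x : N} (hx : x ∈ U) : ∃ p, e.proj p = x := by
  obtain ⟨t, ht, -⟩ := e.exists_trivialization hx
  exact ⟨_, t.proj_symm_apply' (x := (1 : Circle)) ht⟩

theorem smul_left_injective {z w : Circle} {p : e.P} (h : z • p = w • p) : z = w := by
  obtain ⟨t, ht, -, -, ht'⟩ := e.exists_trivialization (e.proj_mem p)
  have := congrArg (fun q => (t q).2) h
  simp only [ht' _ p ht] at this
  exact mul_right_cancel this

theorem exists_smul_eq {p q : e.P} (h : e.proj q = e.proj p) : ∃ z : Circle, q = z • p := by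
  obtain ⟨t, ht, -, -, ht'⟩ := e.exists_trivialization (e.proj_mem p)
  refine ⟨(t q).2 * ((t p).2)⁻¹, t.injOn (t.mem_source.2 (h ▸ ht))
    (t.mem_source.2 (by rwa [e.proj_smul])) (Prod.ext ?_ ?_)⟩
  · refine (t.coe_fst' (h ▸ ht)).trans (h.trans ?_)
    refine (e.proj_smul _ _).symm.trans (t.coe_fst' ?_).symm
    rwa [e.proj_smul]
  · exact (inv_mul_cancel_right _ _).symm.trans (ht' _ p ht).symm

/-- The quotient of two smooth sections has local logarithms, whose derivatives are the differences
of the connection forms along the two sections. -/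
theorem isPotentialAt {s : N → e.P} {z : N → Circle} {b : N}
    (hs : ∀ᶠ y in 𝓝 b, ContMDiffAt 𝓘(ℝ, E) (totalModel E) ∞ s y ∧ e.proj (s y) = y)
    (hr : ∀ᶠ y in 𝓝 b, ContMDiffAt 𝓘(ℝ, E) (totalModel E) ∞ (fun y => z y • s y) y) :
    IsPotentialAt expT1 (fun y => Additive.ofMul (z y))
      (e.conn.pullback 𝓘(ℝ, E) (fun y => z y • s y) - e.conn.pullback 𝓘(ℝ, E) s) b := by
  have hb : b ∈ U := hs.self_of_nhds.2 ▸ e.proj_mem _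
  obtain ⟨t, hbt, hts, -, htz⟩ := e.exists_trivialization hb
  have hz : ∀ᶠ y in 𝓝 b, ContMDiffAt 𝓘(ℝ, E) (𝓡 1) ∞ z y := by
    -- No smoothness of `z` is assumed. In an equivariant trivialization it is the quotient of the
    -- circle coordinates of two smooth sections.
    have hz' : ∀ᶠ y in 𝓝 b, z y = (t (z y • s y)).2 * ((t (s y)).2)⁻¹ := by
      filter_upwards [hs, t.open_baseSet.mem_nhds hbt] with y hy hyt
      rw [htz _ _ (hy.2.symm ▸ hyt), mul_inv_cancel_right]
    filter_upwards [hs, hr, hz'.eventually_nhds, t.open_baseSet.mem_nhds hbt] with y hy hy' hyz hyt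
    have h1 : ∀ p, e.proj p = y → ContMDiffAt (totalModel E) (𝓡 1) ∞ (fun q => (t q).2) p :=
      fun p hp => contMDiffAt_snd.comp p
        (hts.contMDiffAt (t.open_source.mem_nhds (t.mem_source.2 (hp.symm ▸ hyt))))
    refine ContMDiffAt.congr_of_eventuallyEq (ContMDiffAt.mul ?_ (ContMDiffAt.inv ?_)) hyz
    · exact ContMDiffAt.comp (g := fun q => (t q).2) y (h1 _ ((e.proj_smul _ _).trans hy.2)) hy'
    · exact ContMDiffAt.comp (g := fun q => (t q).2) y (h1 _ hy.2) hy.1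
  obtain ⟨u, hu⟩ := exists_local_log hz
  refine ⟨u, ?_⟩
  filter_upwards [hu.eventually_nhds, hs] with y hy hys
  have hu' := hy.self_of_nhds.1.mdifferentiableAt (n := ∞) (by simp)
  refine ⟨congrArg Additive.ofMul hy.self_of_nhds.2, hu', fun v => ?_⟩
  have h1 := e.pullback_exp_smul (hys.1.mdifferentiableAt (by simp)) hu' v
  have h2 : e.conn.pullback 𝓘(ℝ, E) (fun y => z y • s y) y =
      e.conn.pullback 𝓘(ℝ, E) (fun y => Circle.exp (2 * Real.pi * u y) • s y) y :=
    pullback_congr _ (hy.mono fun y h => congrArg (· • s y) h.2)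
  have h3 : e.conn.pullback 𝓘(ℝ, E) (fun y => z y • s y) y (fun _ => v) =
    e.conn.pullback 𝓘(ℝ, E) s y (fun _ => v) + dirDeriv 𝓘(ℝ, E) u y v := by
    rw [h2]; exact h1
  exact (sub_eq_of_eq_add' h3).symm

/-- The connection form along a section, as an object of `C'(Ω)`. -/
def rObj [IsManifold 𝓘(ℝ, E) ∞ N] {W : Opens N} {s : N → e.P}
    (hs : ContMDiffOn 𝓘(ℝ, E) (totalModel E) ∞ s W)
    (hp : ∀ x ∈ W, e.proj (s x) = x) : RObj Ω W where
  form := e.conn.pullback 𝓘(ℝ, E) s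
  smooth := e.smooth_conn.pullback W.isOpen isOpen_univ hs (mapsTo_univ _ _)
  ext_deriv := by
    refine (e.curvature.pullback W.isOpen isOpen_univ hs (mapsTo_univ _ _) e.smooth_conn).congr
      W.isOpen (fun _ _ => rfl) fun x hx => ?_
    have h1 := pullback_comp Ω (e.smooth_proj.mdifferentiable (by simp) (s x))
      ((hs.contMDiffAt (W.isOpen.mem_nhds hx)).mdifferentiableAt (by simp))
    rw [← h1]
    have h2 : e.proj ∘ s =ᶠ[𝓝 x] id := by
      filter_upwards [W.isOpen.mem_nhds hx] with y hy using hp y hy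
    rw [pullback_congr Ω h2, pullback_id]

/-- Every point has a neighbourhood with a smooth section. -/
theorem exists_section {x : N} (hx : x ∈ U) : ∃ (W : Opens N) (s : N → e.P), x ∈ W ∧ W ≤ U ∧
    ContMDiffOn 𝓘(ℝ, E) (totalModel E) ∞ s W ∧ ∀ y ∈ W, e.proj (s y) = y := by
  obtain ⟨t, hxt, -, ht, -⟩ := e.exists_trivialization hx
  refine ⟨⟨t.baseSet, t.open_baseSet⟩, fun y => t.toOpenPartialHomeomorph.symm (y, 1), hxt,
    fun y hy => ?_, ?_, fun y hy => t.proj_symm_apply' hy⟩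
  · have h : e.proj (t.toOpenPartialHomeomorph.symm (y, 1)) = y := t.proj_symm_apply' hy
    exact h ▸ e.proj_mem _
  · exact ht.comp (contMDiff_id.prodMk contMDiff_const).contMDiffOn
      fun y hy => t.mem_target.2 hy

end CircleBundle

theorem CircleHom.exists_smul_eq {U' : Opens N} {e : CircleBundle Ω U} {e' : CircleBundle Ω U'}
    (g : CircleHom e e' V) {p : e.P} {q : e'.P} (hp : e.proj p ∈ V) (h : e.proj p = e'.proj q) :
    ∃ z : Circle, g.toFun ⟨p, hp⟩ = z • q :=
  e'.exists_smul_eq ((g.proj_eq _).trans h)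

/-- The connection form along the image of a section under a morphism. -/
theorem CircleHom.contMDiffAt_and_pullback {U' : Opens N} {e : CircleBundle Ω U}
    {e' : CircleBundle Ω U'} (g : CircleHom e e' V) {s : N → e.P} {r : N → e'.P} {b : N}
    (hbV : b ∈ V) (hs : ∀ᶠ y in 𝓝 b, ContMDiffAt 𝓘(ℝ, E) (totalModel E) ∞ s y ∧ e.proj (s y) = y)
    (hr : ∀ᶠ y in 𝓝 b, ∀ h : e.proj (s y) ∈ V, r y = g.toFun ⟨s y, h⟩) :
    ContMDiffAt 𝓘(ℝ, E) (totalModel E) ∞ r b ∧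
      e'.conn.pullback 𝓘(ℝ, E) r b = e.conn.pullback 𝓘(ℝ, E) s b := by
  classical
  have hb := hs.self_of_nhds
  have hbV' : s b ∈ e.over V := show e.proj (s b) ∈ V from hb.2.symm ▸ hbV
  -- The morphism is defined only over `V`, so `s` is corestricted near `b`; the value away from `b`
  -- is irrelevant.
  let f : N → e.over V := fun y => if h : s y ∈ e.over V then ⟨s y, h⟩ else ⟨s b, hbV'⟩
  have h1 : ∀ᶠ y in 𝓝 b, (f y : e.P) = s y ∧ r y = g.toFun (f y) := by
    filter_upwards [hs, V.isOpen.mem_nhds hbV, hr] with y hy hyV hyr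
    have h : s y ∈ e.over V := show e.proj (s y) ∈ V from hy.2.symm ▸ hyV
    have hf : f y = ⟨s y, h⟩ := dif_pos h
    rw [hf]
    exact ⟨rfl, hyr h⟩
  have hf : ContMDiffAt 𝓘(ℝ, E) (totalModel E) ∞ f b := by
    refine (ContMDiffAt.subtypeVal_comp_iff _ _ _).1 ?_
    exact hb.1.congr_of_eventuallyEq (h1.mono fun y h => h.1)
  have hr' : r =ᶠ[𝓝 b] g.toFun ∘ f := h1.mono fun y h => h.2
  have hs' : Subtype.val ∘ f =ᶠ[𝓝 b] s := h1.mono fun y h => h.1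
  have hf' := hf.mdifferentiableAt (by simp)
  refine ⟨((g.smooth _).comp b hf).congr_of_eventuallyEq hr', ?_⟩
  rw [pullback_congr _ hr', pullback_comp _ (g.smooth.mdifferentiable (by simp) _) hf', g.conn_eq,
    ← pullback_comp _ (contMDiff_subtype_val.mdifferentiable (n := ∞) (by simp) _) hf',
    pullback_congr _ hs']

/-- The transition functions of a classifying cocycle of `C(Ω)` for a choice of sections. -/
theorem exists_transition {I K : Type*} {U : I → Opens N} {c : CechCochain U T1 2}
    (e : ∀ i, CircleBundle Ω (U i)) (g : ∀ i j, CircleHom (e j) (e i) (U i ⊓ U j))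
    (hc : ∀ (s : Fin 3 → I) (p : (e (s 2)).P) (hp : (e (s 2)).proj p ∈ overlap U s)
      (q : (e (s 1)).P) (_ : q = (g (s 1) (s 2)).toFun
        ⟨p, overlap_le U s 1 hp, overlap_le U s 2 hp⟩) (hq' : (e (s 1)).proj q ∈ U (s 0) ⊓ U (s 1)),
      (g (s 0) (s 1)).toFun ⟨q, hq'⟩ = Additive.toMul (c s ⟨(e (s 2)).proj p, hp⟩) •
          (g (s 0) (s 2)).toFun ⟨p, overlap_le U s 0 hp, overlap_le U s 2 hp⟩)
    {V : K → Opens N} (τ : K → I) (hV : ∀ k, V k ≤ U (τ k)) (q : ∀ k x, x ∈ V k → (e (τ k)).P)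
    (hq : ∀ k x hx, (e (τ k)).proj (q k x hx) = x) :
    ∃ z : K → K → N → Circle,
      (∀ k l x hk hl, ∀ h : (e (τ l)).proj (q l x hl) ∈ U (τ k) ⊓ U (τ l),
        (g (τ k) (τ l)).toFun ⟨q l x hl, h⟩ = z k l x • q k x hk) ∧
      ∀ (s : Fin 3 → K) (x : overlap V s),
        Additive.ofMul (z (s 0) (s 1) x) + Additive.ofMul (z (s 1) (s 2) x) =
          cechRefine τ hV T1 2 c s x + Additive.ofMul (z (s 0) (s 2) x) := by
  have hz : ∀ k l x, ∃ z : Circle, ∀ hk hl,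
      ∀ h : (e (τ l)).proj (q l x hl) ∈ U (τ k) ⊓ U (τ l),
        (g (τ k) (τ l)).toFun ⟨q l x hl, h⟩ = z • q k x hk := by
    intro k l x
    by_cases hx : ∃ (_ : x ∈ V k) (hl : x ∈ V l), (e (τ l)).proj (q l x hl) ∈ U (τ k) ⊓ U (τ l)
    · obtain ⟨hk, hl, hx⟩ := hx
      obtain ⟨z, hz⟩ := (g (τ k) (τ l)).exists_smul_eq (q := q k x hk) hx
        ((hq l x hl).trans (hq k x hk).symm)
      exact ⟨z, fun _ _ _ => hz⟩
    · exact ⟨1, fun h1 h2 h3 => (hx ⟨h1, h2, h3⟩).elim⟩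
  choose z hz using hz
  refine ⟨z, hz, ?_⟩
  rintro s ⟨x, hx⟩
  have hm := mem_overlap_iff.1 hx
  have hU : ∀ a, x ∈ U (τ (s a)) := fun a => hV _ (hm a)
  have hp : (e (τ (s 2))).proj (q (s 2) x (hm 2)) ∈ overlap U (τ ∘ s) :=
    (hq _ _ (hm 2)).symm ▸ mem_overlap_iff.2 hU
  have h1 : (e (τ (s 1))).proj (q (s 1) x (hm 1)) ∈ U (τ (s 0)) ⊓ U (τ (s 1)) :=
    (hq _ _ (hm 1)).symm ▸ ⟨hU 0, hU 1⟩
  have h1' : (e (τ (s 1))).proj (z (s 1) (s 2) x • q (s 1) x (hm 1)) ∈ U (τ (s 0)) ⊓ U (τ (s 1)) := by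
    rwa [(e _).proj_smul]
  have h2 := hc (τ ∘ s) (q (s 2) x (hm 2)) hp (z (s 1) (s 2) x • q (s 1) x (hm 1))
    (hz _ _ x (hm 1) (hm 2) _).symm h1'
  have h3 : (g (τ (s 0)) (τ (s 1))).toFun ⟨z (s 1) (s 2) x • q (s 1) x (hm 1), h1'⟩ =
      z (s 1) (s 2) x • z (s 0) (s 1) x • q (s 0) x (hm 0) := by
    rw [← hz _ _ x (hm 0) (hm 1) h1]
    exact (g (τ (s 0)) (τ (s 1))).equivariant _ ⟨q (s 1) x (hm 1), h1⟩ _ rfl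
  have h4 := hz (s 0) (s 2) x (hm 0) (hm 2) ⟨overlap_le U _ 0 hp, overlap_le U _ 2 hp⟩
  have h5 : c (τ ∘ s) ⟨_, hp⟩ = c (τ ∘ s) ⟨x, mem_overlap_iff.2 hU⟩ :=
    congrArg (c (τ ∘ s)) (Subtype.ext (hq _ _ (hm 2)))
  -- Both composites are expressed as multiples of the same point `q (s 0) x`; freeness of the
  -- action then compares the coefficients.
  have h6 := h3.symm.trans (h2.trans (congrArg₂ (fun a b => Additive.toMul a • b) h5 h4))
  rw [← mul_smul, ← mul_smul] at h6
  exact congrArg Additive.ofMul ((mul_comm _ _).trans ((e _).smul_left_injective h6))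

/-- The cocycle identity is purely algebraic: one arbitrary point in each fibre suffices to define
transition functions, without any continuity. -/
theorem IsCircleClassifying.mem_cocycle {I : Type w} {U : I → Opens N} {c : CechCochain U T1 2}
    (h : IsCircleClassifying Ω U c) : c ∈ CechCocycle U T1 2 := by
  obtain ⟨e, g, h⟩ := h
  choose q hq using fun i x (hx : x ∈ U i) => (e i).exists_proj_eq hx
  obtain ⟨z, -, hz⟩ := exists_transition e g (fun s p hp q hq _ => h s p hp q hq) id
    (fun _ => le_rfl) q hq
  exact cocycle_of_pointwise (fun i j x => Additive.ofMul (z i j x)) hz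

/-- A classifying cocycle of `C(Ω)` is locally classifying on a finer cover. -/
theorem IsCircleClassifying.exists_isLocallyClassifying [IsManifold 𝓘(ℝ, E) ∞ N] {I : Type w}
    {U : I → Opens N} {c : CechCochain U T1 2} (h : IsCircleClassifying Ω U c)
    (hU : ∀ x, ∃ i, x ∈ U i) : ∃ (W : PtCover N) (hW : ∀ x, W.1 x ≤ U (hU x).choose),
      IsLocallyClassifying expT1 Ω W.1 (cechRefine (fun x => (hU x).choose) hW T1 2 c) := by
  obtain ⟨e, g, h⟩ := h
  choose W s hxW hW hs hp using fun x => (e (hU x).choose).exists_section (hU x).choose_spec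
  obtain ⟨z, hz, hz'⟩ := exists_transition e g (fun s p hp q hq _ => h s p hp q hq) _ hW
    (fun k x _ => s k x) hp
  refine ⟨⟨W, hxW⟩, hW, fun x => (e _).rObj (hs x) (hp x), fun i j x => Additive.ofMul (z i j x),
    fun i j x hi hj => ?_, hz'⟩
  have hs' : ∀ k y, y ∈ W k → ∀ᶠ x in 𝓝 y, ContMDiffAt 𝓘(ℝ, E) (totalModel E) ∞ (s k) x ∧
      (e (hU k).choose).proj (s k x) = x := by
    intro k y hy
    filter_upwards [(W k).isOpen.mem_nhds hy] with x hx
    exact ⟨(hs k).contMDiffAt ((W k).isOpen.mem_nhds hx), hp k x hx⟩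
  -- The section `z i j • s i` is the image of `s j` under `g i j`. It is therefore smooth, and the
  -- connection forms along the two agree, so the logarithm of `z i j` has differential `e j - e i`.
  have key : ∀ y, y ∈ W i → y ∈ W j →
      ContMDiffAt 𝓘(ℝ, E) (totalModel E) ∞ (fun y => z i j y • s i y) y ∧
      (e (hU i).choose).conn.pullback 𝓘(ℝ, E) (fun y => z i j y • s i y) y =
        (e (hU j).choose).conn.pullback 𝓘(ℝ, E) (s j) y := by
    intro y hyi hyj
    refine (g (hU i).choose (hU j).choose).contMDiffAt_and_pullback ⟨hW i hyi, hW j hyj⟩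
      (hs' j y hyj) ?_
    filter_upwards [(W i ⊓ W j).isOpen.mem_nhds ⟨hyi, hyj⟩] with x hx h
    exact (hz i j x hx.1 hx.2 h).symm
  have hij := (W i ⊓ W j).isOpen.mem_nhds ⟨hi, hj⟩
  obtain ⟨u, hu⟩ := (e (hU i).choose).isPotentialAt (hs' i x hi)
    (Filter.mem_of_superset hij fun y hy => (key y hy.1 hy.2).1)
  refine ⟨u, ?_⟩
  filter_upwards [hu, hij] with y hy hy'
  let b : E [⋀^Fin 1]→L[ℝ] ℝ := (e (hU i).choose).conn.pullback 𝓘(ℝ, E) (s i) y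
  exact ⟨hy.1, hy.2.congr_form (congrArg (fun a : E [⋀^Fin 1]→L[ℝ] ℝ => a - b)
    (key y hy'.1 hy'.2).2.symm)⟩

theorem IsLocallyClassifying.cechClass_eq [IsManifold 𝓘(ℝ, E) ∞ N] {A : Type*} [AddCommGroup A]
    {φ : ℝ →+ A} {I K : Type*} {U : I → Opens N} {V : K → Opens N} {c : CechCocycle U A 2}
    {d : CechCocycle V A 2} (hU : ∀ x, ∃ i, x ∈ U i) (hV : ∀ x, ∃ k, x ∈ V k)
    (hc : IsLocallyClassifying φ Ω U c.1) (hd : IsLocallyClassifying φ Ω V d.1) :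
    cechClass U hU 2 c = cechClass V hV 2 d :=
  IsLocallyClassifying.ptClass_eq (φ := φ) (Ω := Ω) (W := ptRefinement U hU)
    (W' := ptRefinement V hV) (hc.refine _ fun _ => le_rfl) (hd.refine _ fun _ => le_rfl)

/-- The class of a classifying cocycle of `C(Ω)` only depends on `Ω`. -/
theorem IsCircleClassifying.cechClass_eq [IsManifold 𝓘(ℝ, E) ∞ N] {I K : Type*} {U : I → Opens N}
    {V : K → Opens N} {c : CechCocycle U T1 2} {d : CechCocycle V T1 2} (hU : ∀ x, ∃ i, x ∈ U i)
    (hV : ∀ x, ∃ k, x ∈ V k) (hc : IsCircleClassifying Ω U c.1)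
    (hd : IsCircleClassifying Ω V d.1) : cechClass U hU 2 c = cechClass V hV 2 d := by
  obtain ⟨W, hW, hc⟩ := hc.exists_isLocallyClassifying hU
  obtain ⟨W', hW', hd⟩ := hd.exists_isLocallyClassifying hV
  refine (ptClass_refine (W := ptRefinement U hU) (W' := W) hW 2 _).symm.trans (Eq.trans ?_
    (ptClass_refine (W := ptRefinement V hV) (W' := W') hW' 2 _))
  exact IsLocallyClassifying.ptClass_eq (φ := expT1) (Ω := Ω) hc hd

end CircleBundles

end

/-! ### The three claims together -/

theorem proposition2p4p2 {E : Type v} [NormedAddCommGroup E] [NormedSpace ℝ E]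
    [FiniteDimensional ℝ E] {N : Type u} [TopologicalSpace N] [ChartedSpace E N]
    [IsManifold 𝓘(ℝ, E) ∞ N] [T2Space N] [ParacompactSpace N]
    (Ω : DiffForm 𝓘(ℝ, E) N 2) (hsm : Ω.SmoothOn Set.univ)
    (hclosed : Ω.IsExtDerivOn 0 Set.univ) :
    -- the exact sequence in cohomology
    (∃ δ : ∀ n : ℕ, CechH N T1 n →+ CechH N ℤ (n + 1),
      ∀ n, IsConnecting n (δ n) ∧
        Function.Exact (cechHMap N intIncl n) (cechHMap N expT1 n) ∧
        Function.Exact (cechHMap N expT1 n) (δ n) ∧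
        Function.Exact (δ n) (cechHMap N intIncl (n + 1))) ∧
    -- the class of `C'(Ω)` is mapped to the class of `C(Ω)`
    (∃ (h' : CechH N ℝ 2) (h : CechH N T1 2),
      IsClassOf (fun U c => IsRClassifying Ω U c) h' ∧
      IsClassOf (fun U c => IsCircleClassifying Ω U c) h ∧
      cechHMap N expT1 2 h' = h) ∧
    -- the statement for cocycles
    (∀ {I : Type w} (U : I → Opens N) (c : CechCochain U ℝ 2), (∀ x, ∃ i, x ∈ U i) →
      IsRClassifying Ω U c → IsCircleClassifying Ω U (cechCoeff U expT1 2 c)) := by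
  refine ⟨exists_connecting_exact, ?_, fun _ _ _ h => h.isCircleClassifying⟩
  obtain ⟨U, c, hU, hc⟩ := exists_isRClassifying hsm hclosed
  -- The class in `H^2(N, T^1)` is taken to be the image of the real one, so compatibility holds by
  -- `rfl`. What remains is that any classifying cocycle of either gerbe is cohomologous to `c` or
  -- to its exponential.
  refine ⟨cechClass U hU 2 ⟨c, hc.mem_cocycle⟩, _,
    ⟨⟨N, U, c, hU, hc⟩, fun I V d hV hd => ⟨hd.mem_cocycle, ?_⟩⟩,
    ⟨⟨N, U, _, hU, hc.isCircleClassifying⟩, fun I V d hV hd => ⟨hd.mem_cocycle, ?_⟩⟩, rfl⟩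
  · exact IsLocallyClassifying.cechClass_eq hV hU hd.isLocallyClassifying hc.isLocallyClassifying
  · rw [cechHMap_cechClass]
    exact IsCircleClassifying.cechClass_eq hV hU hd hc.isCircleClassifying
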